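/- Let $(V_k)_{k\ge1}$ be i.i.d. real random variables with mean zero and finite variance $\sigma^2>0$. Let $(k_n)_{n\ge1}$ be positive numbers with $k_n\to\infty$ and $k_n=o(n)$, let $\gamma_1,\gamma_2>0$, and put $\theta_n=1+\gamma_1/k_n$, $\rho_n=1+\gamma_2/k_n$. For each $n\ge1$ let $X_{0,n}=\varepsilon_{0,n}=0$ and $$X_{k,n}=\theta_nX_{k-1,n}+\varepsilon_{k,n},\qquad \varepsilon_{k,n}=\rho_n\varepsilon_{k-1,n}+V_k,\qquad k=1,\dots,n,$$ and let $$\hat\theta_n=\frac{\sum_{k=1}^nX_{k,n}X_{k-1,n}}{\sum_{k=1}^nX_{k-1,n}^2}$$ be the least squares estimator of $\theta_n$ (with an arbitrary convention, say $\hat\theta_n=0$, where the denominator vanishes). Then, as $n\to\infty$, with $\stackrel{\mathcal L}{\longrightarrow}$ denoting convergence in distribution: (1) if $\gamma_1>\gamma_2$, then $$\frac{\gamma_1+\gamma_2}{2\gamma_1(\gamma_1-\gamma_2)}\,k_n\theta_n^n\rho_n^{-n}(\hat\theta_n-\theta_n)\stackrel{\mathcal L}{\longrightarrow}\frac{\xi_\rho}{\xi_\theta};$$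 (2) if $\gamma_2>\gamma_1$, then $$\frac{\gamma_1+\gamma_2}{2\gamma_2(\gamma_2-\gamma_1)}\,\rho_n^n\theta_n^{-n}\bigl(k_n(\hat\theta_n-\theta_n)-(\gamma_2-\gamma_1)\bigr)\stackrel{\mathcal L}{\longrightarrow}\frac{\xi_\theta}{\xi_\rho},$$ where in (1) and (2) the vector $(\xi_\theta,\xi_\rho)$ is Gaussian $N(0,\Lambda)$ with $$\Lambda=\begin{pmatrix}\frac{\sigma^2}{2\gamma_1}&\frac{\sigma^2}{\gamma_1+\gamma_2}\\ \frac{\sigma^2}{\gamma_1+\gamma_2}&\frac{\sigma^2}{2\gamma_2}\end{pmatrix};$$ (3) if $\gamma_1=\gamma_2=\gamma$, then $$\frac n{k_n}\bigl(n(\hat\theta_n-\theta_n)-\theta_n\bigr)\stackrel{\mathcal L}{\longrightarrow}\frac{\zeta_\theta}{\varphi_\theta},$$ where $(\varphi_\theta,\zeta_\theta)$ is Gaussian $N(0,\Xi)$ with $$\Xi=\begin{pmatrix}\frac{\sigma^2}{2\gamma}&\frac{\sigma^2}{2\gamma^2}\\ \frac{\sigma^2}{2\gamma^2}&\frac{5\sigma^2}{8\gamma^3}\end{pmatrix}.$$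 Moreover, the limit laws in (1), (2), (3) are Cauchy laws (with some positive scale) centered at $2\gamma_1/(\gamma_1+\gamma_2)$, $2\gamma_2/(\gamma_1+\gamma_2)$ and $1/\gamma$, respectively. -/

import Mathlib

open MeasureTheory ProbabilityTheory Filter Topology
open scoped NNReal ENNReal

/-- The autoregressive errors `ε_k = ρ ε_{k-1} + V_k` with `ε_0 = 0`, driven by `V_1, V_2, …`
(the value `V 0` is not used). -/
def arError (ρ : ℝ) (V : ℕ → ℝ) : ℕ → ℝ
  | 0 => 0
  | k + 1 => ρ * arError ρ V k + V (k + 1)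

/-- The observed process `X_k = θ X_{k-1} + ε_k` with `X_0 = 0`, where `ε` are the autoregressive
errors with parameter `ρ`. -/
def arProcess (θ ρ : ℝ) (V : ℕ → ℝ) : ℕ → ℝ
  | 0 => 0
  | k + 1 => θ * arProcess θ ρ V k + arError ρ V (k + 1)

/-- The least squares estimator `(∑_{k=1}^n X_k X_{k-1}) / (∑_{k=1}^n X_{k-1}^2)`. -/
noncomputable def lsEstimator (n : ℕ) (X : ℕ → ℝ) : ℝ :=
  (∑ k ∈ Finset.Icc 1 n, X k * X (k - 1)) / ∑ k ∈ Finset.Icc 1 n, X (k - 1) ^ 2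

/-- The estimator of `θ` computed from the first `n` terms of the path of the model with parameters
`θ`, `ρ` and noise `V 1, V 2, …`. -/
noncomputable def thetaHat (θ ρ : ℝ) (n : ℕ) (V : ℕ → ℝ) : ℝ :=
  lsEstimator n (arProcess θ ρ V)

/-- The covariance matrix of the Gaussian vector `(ξ_θ, ξ_ρ)`. -/
noncomputable def covLambda (σ γ₁ γ₂ : ℝ) : Matrix (Fin 2) (Fin 2) ℝ :=
  !![σ ^ 2 / (2 * γ₁), σ ^ 2 / (γ₁ + γ₂);
     σ ^ 2 / (γ₁ + γ₂), σ ^ 2 / (2 * γ₂)]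

/-- The covariance matrix of the Gaussian vector `(φ_θ, ζ_θ)`. -/
noncomputable def covXi (σ γ : ℝ) : Matrix (Fin 2) (Fin 2) ℝ :=
  !![σ ^ 2 / (2 * γ), σ ^ 2 / (2 * γ ^ 2);
     σ ^ 2 / (2 * γ ^ 2), 5 * σ ^ 2 / (8 * γ ^ 3)]

/-!
# The least squares estimator in an explosive autoregression with autoregressive errors

All quantities are quadratic in the linear forms `∑ c_j V_{j+1}` of the innovations. The process is
`X_i = (θ P_i - ρ Q_i) / (θ - ρ)`, where `P` and `Q` are the first order autoregressions with
parameters `θ` and `ρ` (`sub_mul_arProcess`), and for `θ = ρ` it is the corresponding derivative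
(`mul_arProcess_self_eq_sum`). An explosive autoregression is governed by its first innovations:
`P_i` is close to `θ ^ i √k T` with `T = ∑_{j < n} θ ^ (-(j+1)) V_{j+1} / √k`. So, after
normalization, the array of coefficients of `(X_i)_{i < n}` is close in Hilbert-Schmidt norm to a
rank one array `u ⊗ w`, and the array of the process multiplying `X` in the numerator of the
estimation error is close to `s ⊗ w + s' ⊗ w'`. The variances of linear forms being sums of squares
of coefficients, numerator and denominator are then close in `L¹` to `κ T S` and `κ T ^ 2`, where
`T` and `S` are the linear forms with weights `w` and `w'`
(`tendsto_integral_abs_sum_mul_sub_quadratic`). The pair `(T, S)` has a Gaussian limit `(φ, ζ)` by a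
central limit theorem for triangular arrays of weights (`tendstoInDistribution_weighted_sums`), and
since `φ ≠ 0` almost surely the quotient converges to `ζ / φ` (`tendstoInDistribution_div`); this
needs no separate treatment of the event that the denominator of the estimator vanishes. These
steps are combined in `tendstoInDistribution_quotient`, which reduces each regime to limits of
geometric sums.

For distinct rates, `θ` and `ρ` play symmetric roles in `X` (`arProcess_comm`), and centring the
estimator at `ρ` instead of `θ` replaces the autoregressive errors with parameter `ρ` by those with
parameter `θ` (`thetaHat_sub_eq'`). Hence the case `γ₁ < γ₂` is the case `γ₂ < γ₁` with the
parameters exchanged. For equal rates the leading terms of `n ε` and `θ X` cancel, so the second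
Gaussian variable is a first moment sum `∑ (j+1) θ ^ (-(j+1)) V_{j+1}` corrected by a multiple of
`T`.

The limits are Cauchy because a centred Gaussian vector has the law of `(x, c x + s y)` with `x`,
`y` independent of equal variance (`multivariateGaussian_eq_map_prod`), so that the quotient is
`c + s y / x`.
-/

/-! ### A central limit theorem for weighted sums -/

lemma norm_prod_sub_prod_le_sum {ι : Type*} (s : Finset ι) (f g : ι → ℂ)
    (hf : ∀ i, ‖f i‖ ≤ 1) (hg : ∀ i, ‖g i‖ ≤ 1) :
    ‖∏ i ∈ s, f i - ∏ i ∈ s, g i‖ ≤ ∑ i ∈ s, ‖f i - g i‖ := by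
  classical
  induction s using Finset.induction_on with
  | empty => simp
  | insert a s ha ih =>
    rw [Finset.prod_insert ha, Finset.prod_insert ha, Finset.sum_insert ha]
    have h1 : ‖∏ i ∈ s, f i‖ ≤ 1 := by
      rw [norm_prod]
      exact Finset.prod_le_one (fun _ _ => norm_nonneg _) (fun i _ => hf i)
    calc ‖f a * ∏ i ∈ s, f i - g a * ∏ i ∈ s, g i‖
        = ‖(f a - g a) * ∏ i ∈ s, f i + g a * (∏ i ∈ s, f i - ∏ i ∈ s, g i)‖ := by
          congr 1; ring
      _ ≤ ‖f a - g a‖ * ‖∏ i ∈ s, f i‖ + ‖g a‖ * ‖∏ i ∈ s, f i - ∏ i ∈ s, g i‖ := by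
          refine (norm_add_le _ _).trans ?_
          rw [norm_mul, norm_mul]
      _ ≤ ‖f a - g a‖ * 1 + 1 * ∑ i ∈ s, ‖f i - g i‖ := by
          gcongr
          exact hg a
      _ = _ := by ring

lemma charFun_isLittleO_of_mean_zero {μ : Measure ℝ} [IsProbabilityMeasure μ] {v : ℝ}
    (hL2 : MemLp id 2 μ) (h0 : ∫ x, x ∂μ = 0) (h2 : ∫ x, x ^ 2 ∂μ = v) :
    (fun t => charFun μ t - (1 - v * t ^ 2 / 2)) =o[𝓝 0] fun t => t ^ 2 := by
  have key : ∀ t : ℝ, taylorWithinEval (charFun μ) 2 Set.univ 0 t = 1 - v * t ^ 2 / 2 := by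
    intro t
    have := taylorWithinEval_charFun_two_zero (P := μ) (X := id) aemeasurable_id
      (by simpa using hL2) t
    rw [Measure.map_id] at this
    rw [this]
    simp [h0, h2]
  simp_rw [← key]
  convert! taylor_isLittleO_univ ?_
  · simp
  exact contDiff_charFun hL2

/-- Lindeberg's replacement principle for characteristic functions: in a product over an
infinitesimal array of arguments, the law may be replaced by one with the same first two moments. -/
lemma tendsto_prod_charFun_sub_prod_charFun {μ ν : Measure ℝ} [IsProbabilityMeasure μ]
    [IsProbabilityMeasure ν] {v : ℝ}
    (hμ : MemLp id 2 μ) (hμ0 : ∫ x, x ∂μ = 0) (hμ2 : ∫ x, x ^ 2 ∂μ = v)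
    (hν : MemLp id 2 ν) (hν0 : ∫ x, x ∂ν = 0) (hν2 : ∫ x, x ^ 2 ∂ν = v)
    {c : ℕ → ℕ → ℝ} {δ : ℕ → ℝ} (hδ : Tendsto δ atTop (𝓝 0))
    (hc : ∀ᶠ n in atTop, ∀ j < n, |c n j| ≤ δ n) {s : ℝ}
    (hs : Tendsto (fun n => ∑ j ∈ Finset.range n, c n j ^ 2) atTop (𝓝 s)) :
    Tendsto (fun n => ∏ j ∈ Finset.range n, charFun μ (c n j)
      - ∏ j ∈ Finset.range n, charFun ν (c n j)) atTop (𝓝 0) := by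
  have hlo : (fun t => charFun μ t - charFun ν t) =o[𝓝 0] fun t => t ^ 2 := by
    refine ((charFun_isLittleO_of_mean_zero hμ hμ0 hμ2).sub
      (charFun_isLittleO_of_mean_zero hν hν0 hν2)).congr_left fun t => ?_
    ring
  rw [Metric.tendsto_atTop']
  intro ε hε
  have hM : 0 < |s| + 1 := by positivity
  have hη : 0 < ε / (|s| + 1) := by positivity
  obtain ⟨r, hr, hball⟩ := Metric.eventually_nhds_iff.1 (hlo.def hη)
  have h1 : ∀ᶠ n in atTop, δ n < r := hδ.eventually_lt_const hr
  have h2 : ∀ᶠ n in atTop, ∑ j ∈ Finset.range n, c n j ^ 2 < |s| + 1 :=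
    hs.eventually_lt_const (by linarith [le_abs_self s])
  obtain ⟨N, hN⟩ := eventually_atTop.1 (h1.and (h2.and hc))
  refine ⟨N, fun n hn => ?_⟩
  obtain ⟨h1, h2, hc⟩ := hN n hn.le
  rw [dist_zero_right]
  calc _ ≤ ∑ j ∈ Finset.range n, ‖charFun μ (c n j) - charFun ν (c n j)‖ :=
        norm_prod_sub_prod_le_sum _ _ _ (fun _ => norm_charFun_le_one _)
          (fun _ => norm_charFun_le_one _)
    _ ≤ ∑ j ∈ Finset.range n, ε / (|s| + 1) * c n j ^ 2 := by
        refine Finset.sum_le_sum fun j hj => ?_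
        have := hball (y := c n j) (by
          rw [dist_zero_right, Real.norm_eq_abs]
          exact (hc j (Finset.mem_range.1 hj)).trans_lt h1)
        simpa using this
    _ = ε / (|s| + 1) * ∑ j ∈ Finset.range n, c n j ^ 2 := by rw [Finset.mul_sum]
    _ < ε / (|s| + 1) * (|s| + 1) := by gcongr
    _ = ε := by field_simp

lemma tendsto_prod_charFun {μ : Measure ℝ} [IsProbabilityMeasure μ] {v : ℝ} (hv : 0 ≤ v)
    (hμ : MemLp id 2 μ) (hμ0 : ∫ x, x ∂μ = 0) (hμ2 : ∫ x, x ^ 2 ∂μ = v)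
    {c : ℕ → ℕ → ℝ} {δ : ℕ → ℝ} (hδ : Tendsto δ atTop (𝓝 0))
    (hc : ∀ᶠ n in atTop, ∀ j < n, |c n j| ≤ δ n) {s : ℝ}
    (hs : Tendsto (fun n => ∑ j ∈ Finset.range n, c n j ^ 2) atTop (𝓝 s)) :
    Tendsto (fun n => ∏ j ∈ Finset.range n, charFun μ (c n j)) atTop
      (𝓝 (Complex.exp (-(v * s / 2 : ℝ)))) := by
  have hg0 : ∫ x, x ∂(gaussianReal 0 v.toNNReal) = 0 := integral_id_gaussianReal
  have hg : MemLp id 2 (gaussianReal 0 v.toNNReal) := by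
    exact_mod_cast memLp_id_gaussianReal 2
  have hg2 : ∫ x, x ^ 2 ∂(gaussianReal 0 v.toNNReal) = v := by
    have h := variance_id_gaussianReal (μ := 0) (v := v.toNNReal)
    rw [variance_of_integral_eq_zero aemeasurable_id hg0] at h
    simpa [hv] using h
  have h := tendsto_prod_charFun_sub_prod_charFun hμ hμ0 hμ2 hg hg0 hg2 hδ hc hs
  have h' : Tendsto (fun n => ∏ j ∈ Finset.range n, charFun (gaussianReal 0 v.toNNReal) (c n j))
      atTop (𝓝 (Complex.exp (-(v * s / 2 : ℝ)))) := by
    have h3 : ∀ n, ∏ j ∈ Finset.range n, charFun (gaussianReal 0 v.toNNReal) (c n j)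
        = Complex.exp (-(v * (∑ j ∈ Finset.range n, c n j ^ 2) / 2 : ℝ)) := by
      intro n
      simp_rw [charFun_gaussianReal]
      rw [← Complex.exp_sum]
      congr 1
      push_cast
      rw [Finset.mul_sum, Finset.sum_div, ← Finset.sum_neg_distrib]
      refine Finset.sum_congr rfl fun j _ => ?_
      simp [hv]
    simp_rw [h3]
    refine (Complex.continuous_exp.tendsto _).comp ?_
    refine Tendsto.neg ((Complex.continuous_ofReal.tendsto _).comp ?_)
    exact (hs.const_mul v).div_const 2
  simpa using h.add h'

/-- The bivariate central limit theorem for weighted sums of i.i.d. centred variables, the weights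
forming infinitesimal triangular arrays. -/
theorem tendstoInDistribution_weighted_sums
    {Ω Ω' : Type*} [MeasurableSpace Ω] [MeasurableSpace Ω']
    {P : Measure Ω} [IsProbabilityMeasure P] {P' : Measure Ω'} [IsProbabilityMeasure P']
    {W : ℕ → Ω → ℝ} {v : ℝ} (hindep : iIndepFun W P)
    (hident : ∀ j, IdentDistrib (W j) (W 0) P P)
    (hL2 : MemLp (W 0) 2 P) (hmean : ∫ ω, W 0 ω ∂P = 0) (hvar : ∫ ω, W 0 ω ^ 2 ∂P = v)
    {w w' : ℕ → ℕ → ℝ} {δ δ' : ℕ → ℝ} (hδ : Tendsto δ atTop (𝓝 0)) (hδ' : Tendsto δ' atTop (𝓝 0))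
    (hw : ∀ᶠ n in atTop, ∀ j < n, |w n j| ≤ δ n) (hw' : ∀ᶠ n in atTop, ∀ j < n, |w' n j| ≤ δ' n)
    {p q r : ℝ}
    (hp : Tendsto (fun n => ∑ j ∈ Finset.range n, w n j ^ 2) atTop (𝓝 p))
    (hq : Tendsto (fun n => ∑ j ∈ Finset.range n, w n j * w' n j) atTop (𝓝 q))
    (hr : Tendsto (fun n => ∑ j ∈ Finset.range n, w' n j ^ 2) atTop (𝓝 r))
    (hS : (!![v * p, v * q; v * q, v * r] : Matrix (Fin 2) (Fin 2) ℝ).PosSemidef)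
    {φ ζ : Ω' → ℝ}
    (hlaw : HasLaw (fun ω => !₂[φ ω, ζ ω])
      (multivariateGaussian 0 !![v * p, v * q; v * q, v * r]) P') :
    TendstoInDistribution
      (fun n ω => !₂[∑ j ∈ Finset.range n, w n j * W j ω, ∑ j ∈ Finset.range n, w' n j * W j ω])
      atTop (fun ω => !₂[φ ω, ζ ω]) (fun _ => P) P' := by
  have hWm : ∀ j, AEMeasurable (W j) P := fun j => (hident j).aemeasurable_fst
  have hTm : ∀ c : ℕ → ℝ, ∀ n, AEMeasurable (fun ω => ∑ j ∈ Finset.range n, c j * W j ω) P :=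
    fun c n => Finset.aemeasurable_fun_sum _ fun j _ => (hWm j).const_mul _
  have hm : ∀ n, AEMeasurable (fun ω => !₂[∑ j ∈ Finset.range n, w n j * W j ω,
      ∑ j ∈ Finset.range n, w' n j * W j ω]) P := by
    intro n
    have h : Measurable (fun x : ℝ × ℝ => !₂[x.1, x.2]) := by fun_prop
    exact h.comp_aemeasurable ((hTm _ n).prodMk (hTm _ n))
  refine ⟨hm, hlaw.aemeasurable, ?_⟩
  refine ProbabilityMeasure.tendsto_iff_tendsto_charFun.2 fun t => ?_
  have hv : 0 ≤ v := hvar ▸ integral_nonneg fun _ => sq_nonneg _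
  set μ := P.map (W 0) with hμdef
  have : IsProbabilityMeasure μ := Measure.isProbabilityMeasure_map (hWm 0)
  have hμ : MemLp id 2 μ := (memLp_map_measure_iff aestronglyMeasurable_id (hWm 0)).2 hL2
  have hμ0 : ∫ x, x ∂μ = 0 := by
    rw [hμdef, integral_map (f := fun x : ℝ => x) (hWm 0) aestronglyMeasurable_id]; exact hmean
  have hμ2 : ∫ x, x ^ 2 ∂μ = v := by
    rw [hμdef, integral_map (hWm 0) (by fun_prop)]; exact hvar
  set c : ℕ → ℕ → ℝ := fun n j => t 0 * w n j + t 1 * w' n j with hcdef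
  have hL : ∀ n, charFun (P.map (fun ω => !₂[∑ j ∈ Finset.range n, w n j * W j ω,
      ∑ j ∈ Finset.range n, w' n j * W j ω])) t = ∏ j ∈ Finset.range n, charFun μ (c n j) := by
    intro n
    have h1 : charFun (P.map (fun ω => !₂[∑ j ∈ Finset.range n, w n j * W j ω,
        ∑ j ∈ Finset.range n, w' n j * W j ω])) t
        = charFun (P.map (fun ω => ∑ j ∈ Finset.range n, c n j * W j ω)) 1 := by
      rw [charFun_apply, charFun_apply, integral_map (hm n) (by fun_prop),
        integral_map (hTm _ n) (by fun_prop)]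
      congr 1 with ω
      congr 3
      simp only [hcdef, PiLp.inner_apply, Fin.sum_univ_two]
      simp [Finset.mul_sum, ← Finset.sum_add_distrib]
      refine Finset.sum_congr rfl fun j _ => by ring
    rw [h1]
    have hind : iIndepFun (fun j ω => c n j * W j ω) P :=
      hindep.comp (fun j x => c n j * x) (fun j => by fun_prop)
    rw [(hind.restrict _).charFun_map_fun_finsetSum_eq_prod (fun j _ => (hWm j).const_mul _)]
    rw [Finset.prod_apply]
    refine Finset.prod_congr rfl fun j _ => ?_
    rw [charFun_map_mul_comp (hWm j), (hident j).map_eq, mul_one]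
  have hR : charFun (P'.map (fun ω => !₂[φ ω, ζ ω])) t = Complex.exp
      (-(v * (t 0 ^ 2 * p + 2 * (t 0 * t 1) * q + t 1 ^ 2 * r) / 2 : ℝ)) := by
    rw [hlaw.map_eq, charFun_multivariateGaussian hS]
    congr 1
    simp [Matrix.mulVec, dotProduct, Fin.sum_univ_two]
    ring
  change Tendsto (fun n => charFun (P.map _) t) atTop (𝓝 (charFun (P'.map _) t))
  rw [hR]
  simp_rw [hL]
  refine tendsto_prod_charFun hv hμ hμ0 hμ2 (δ := fun n => |t 0| * δ n + |t 1| * δ' n) ?_ ?_ ?_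
  · simpa using (hδ.const_mul |t 0|).add (hδ'.const_mul |t 1|)
  · filter_upwards [hw, hw'] with n h h' j hj
    refine (abs_add_le _ _).trans ?_
    rw [abs_mul, abs_mul]
    gcongr
    exacts [h j hj, h' j hj]
  · have := ((hp.const_mul (t 0 ^ 2)).add (hq.const_mul (2 * (t 0 * t 1)))).add
      (hr.const_mul (t 1 ^ 2))
    refine this.congr fun n => ?_
    simp only [Finset.mul_sum, ← Finset.sum_add_distrib, hcdef]
    refine Finset.sum_congr rfl fun j _ => by ring

/-! ### Quotients of sequences converging in distribution -/

/-- The continuous mapping theorem for a quotient whose limiting denominator is almost surely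
nonzero. The quotient `Z n` may take any value where its denominator vanishes. -/
theorem tendstoInDistribution_div
    {Ω Ω' : Type*} [MeasurableSpace Ω] [MeasurableSpace Ω']
    {P : Measure Ω} [IsProbabilityMeasure P] {P' : Measure Ω'} [IsProbabilityMeasure P']
    {A D Z : ℕ → Ω → ℝ} {A' D' : Ω' → ℝ}
    (h : TendstoInDistribution (fun n ω => (A n ω, D n ω)) atTop (fun ω => (A' ω, D' ω))
      (fun _ => P) P')
    (hD : ∀ᵐ ω ∂P', D' ω ≠ 0) (hZm : ∀ n, AEMeasurable (Z n) P)
    (hZ : ∀ᶠ n in atTop, ∀ ω, D n ω ≠ 0 → Z n ω = A n ω / D n ω) :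
    TendstoInDistribution Z atTop (fun ω => A' ω / D' ω) (fun _ => P) P' := by
  have hdiv : Measurable fun x : ℝ × ℝ => x.1 / x.2 := by fun_prop
  have hlim : AEMeasurable (fun ω => A' ω / D' ω) P' := hdiv.comp_aemeasurable h.aemeasurable_limit
  refine ⟨hZm, hlim, ?_⟩
  refine tendsto_of_forall_isOpen_le_liminf' fun G hG => ?_
  have hO : IsOpen {x : ℝ × ℝ | x.2 ≠ 0 ∧ x.1 / x.2 ∈ G} := by
    have h1 : IsOpen {x : ℝ × ℝ | x.2 ≠ 0} := isOpen_ne_fun continuous_snd continuous_const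
    have h2 : ContinuousOn (fun x : ℝ × ℝ => x.1 / x.2) {x : ℝ × ℝ | x.2 ≠ 0} :=
      continuousOn_fst.div continuousOn_snd fun x hx => hx
    exact h2.isOpen_inter_preimage h1 hG
  have hl := ProbabilityMeasure.le_liminf_measure_open_of_tendsto h.tendsto hO
  simp only [ProbabilityMeasure.coe_mk] at hl ⊢
  rw [Measure.map_apply_of_aemeasurable h.aemeasurable_limit hO.measurableSet] at hl
  rw [Measure.map_apply_of_aemeasurable hlim hG.measurableSet]
  calc P' ((fun ω => A' ω / D' ω) ⁻¹' G)
      ≤ P' ((fun ω => (A' ω, D' ω)) ⁻¹' {x : ℝ × ℝ | x.2 ≠ 0 ∧ x.1 / x.2 ∈ G}) := by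
        refine measure_mono_ae ?_
        filter_upwards [hD] with ω hω hG
        exact ⟨hω, hG⟩
    _ ≤ _ := hl
    _ ≤ _ := by
        refine liminf_le_liminf ?_
        filter_upwards [hZ] with n hn
        rw [Measure.map_apply_of_aemeasurable (h.forall_aemeasurable n) hO.measurableSet,
          Measure.map_apply_of_aemeasurable (hZm n) hG.measurableSet]
        refine measure_mono fun ω hω => ?_
        have h2 : A n ω / D n ω ∈ G := hω.2
        rw [← hn ω hω.1] at h2
        exact h2

lemma tendstoInMeasure_zero_of_integral_abs {Ω : Type*} [MeasurableSpace Ω] {P : Measure Ω}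
    {f : ℕ → Ω → ℝ} (hf : ∀ n, Integrable (f n) P)
    (h : Tendsto (fun n => ∫ ω, |f n ω| ∂P) atTop (𝓝 0)) :
    TendstoInMeasure P f atTop 0 := by
  refine tendstoInMeasure_of_tendsto_eLpNorm one_ne_zero
    (fun n => (hf n).aestronglyMeasurable) aestronglyMeasurable_zero ?_
  have : ∀ n, eLpNorm (f n - 0) 1 P = ENNReal.ofReal (∫ ω, |f n ω| ∂P) := by
    intro n
    rw [sub_zero, eLpNorm_one_eq_lintegral_enorm,
      ← ofReal_integral_norm_eq_lintegral_enorm (hf n)]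
    simp [Real.norm_eq_abs]
  simp_rw [this]
  simpa using ENNReal.tendsto_ofReal h

/-- If `(T n, S n)` converges in distribution to `(φ, ζ)` with `φ ≠ 0` a.s., and `A n`, `D n` are
asymptotically `c T S` and `c T ^ 2` in `L¹`, then the quotient of `A n` by `D n` converges in
distribution to `ζ / φ`. -/
theorem tendstoInDistribution_div_of_integral_abs
    {Ω Ω' : Type*} [MeasurableSpace Ω] [MeasurableSpace Ω']
    {P : Measure Ω} [IsProbabilityMeasure P] {P' : Measure Ω'} [IsProbabilityMeasure P']
    {T S A D Z : ℕ → Ω → ℝ} {φ ζ : Ω' → ℝ} {c : ℝ} (hc : c ≠ 0)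
    (h : TendstoInDistribution (fun n ω => !₂[T n ω, S n ω]) atTop (fun ω => !₂[φ ω, ζ ω])
      (fun _ => P) P')
    (hφ : ∀ᵐ ω ∂P', φ ω ≠ 0) (hZm : ∀ n, AEMeasurable (Z n) P)
    (hAm : ∀ n, AEMeasurable (A n) P) (hDm : ∀ n, AEMeasurable (D n) P)
    (hAi : ∀ n, Integrable (fun ω => A n ω - c * (T n ω * S n ω)) P)
    (hDi : ∀ n, Integrable (fun ω => D n ω - c * T n ω ^ 2) P)
    (hA : Tendsto (fun n => ∫ ω, |A n ω - c * (T n ω * S n ω)| ∂P) atTop (𝓝 0))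
    (hD : Tendsto (fun n => ∫ ω, |D n ω - c * T n ω ^ 2| ∂P) atTop (𝓝 0))
    (hZ : ∀ᶠ n in atTop, ∀ ω, D n ω ≠ 0 → Z n ω = A n ω / D n ω) :
    TendstoInDistribution Z atTop (fun ω => ζ ω / φ ω) (fun _ => P) P' := by
  have hg : Continuous fun x : EuclideanSpace ℝ (Fin 2) => (c * (x 0 * x 1), c * x 0 ^ 2) := by
    fun_prop
  have h1 := h.continuous_comp hg
  have h2 : TendstoInDistribution (fun n ω => (A n ω, D n ω)) atTop
      (fun ω => (c * (φ ω * ζ ω), c * φ ω ^ 2)) (fun _ => P) P' := by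
    refine tendstoInDistribution_of_tendstoInMeasure_sub _ _ h1 ?_
      (fun n => (hAm n).prodMk (hDm n))
    have hA' := tendstoInMeasure_zero_of_integral_abs hAi hA
    have hD' := tendstoInMeasure_zero_of_integral_abs hDi hD
    rw [tendstoInMeasure_iff_norm] at hA' hD' ⊢
    intro ε hε
    have h3 := (hA' ε hε).add (hD' ε hε)
    rw [add_zero] at h3
    refine tendsto_of_tendsto_of_tendsto_of_le_of_le tendsto_const_nhds h3 (fun _ => zero_le)
      fun n => ?_
    refine (measure_mono fun ω hω => ?_).trans (measure_union_le _ _)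
    simpa [Prod.norm_def] using hω
  have h3 := tendstoInDistribution_div h2
    (hφ.mono fun ω hω => mul_ne_zero hc (pow_ne_zero 2 hω)) hZm hZ
  refine h3.congr (fun _ => Filter.EventuallyEq.rfl) ?_
  filter_upwards [hφ] with ω hω
  field_simp

/-! ### Bilinear functionals of square integrable orthogonal variables -/

section Orthogonal

variable {Ω : Type*} [MeasurableSpace Ω] {P : Measure Ω} {W : ℕ → Ω → ℝ} {v : ℝ}

lemma memLp_weighted_sum (hL2 : ∀ j, MemLp (W j) 2 P) (n : ℕ) (c : ℕ → ℝ) :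
    MemLp (fun ω => ∑ j ∈ Finset.range n, c j * W j ω) 2 P :=
  memLp_finsetSum _ fun j _ => (hL2 j).const_mul (c j)

lemma integral_weighted_sum_sq (hL2 : ∀ j, MemLp (W j) 2 P)
    (horth : ∀ i j, ∫ ω, W i ω * W j ω ∂P = if i = j then v else 0) (n : ℕ) (c : ℕ → ℝ) :
    ∫ ω, (∑ j ∈ Finset.range n, c j * W j ω) ^ 2 ∂P = v * ∑ j ∈ Finset.range n, c j ^ 2 := by
  have hint : ∀ i j, Integrable (fun ω => c i * W i ω * (c j * W j ω)) P := fun i j =>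
    ((hL2 i).const_mul (c i)).integrable_mul ((hL2 j).const_mul (c j))
  simp_rw [sq (∑ j ∈ Finset.range n, c j * W j _), Finset.sum_mul_sum]
  rw [integral_finsetSum _ fun i _ => integrable_finsetSum _ fun j _ => hint i j]
  rw [Finset.mul_sum]
  refine Finset.sum_congr rfl fun i hi => ?_
  rw [integral_finsetSum _ fun j _ => hint i j]
  have : ∀ j, ∫ ω, c i * W i ω * (c j * W j ω) ∂P = c i * c j * if i = j then v else 0 := by
    intro j
    rw [← horth, ← integral_const_mul]
    congr 1 with ω
    ring
  simp_rw [this]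
  rw [Finset.sum_eq_single_of_mem i hi fun j _ hj => by simp [hj.symm]]
  simp
  ring

lemma abs_mul_sub_mul_le {x y x' y' η : ℝ} (hη : 0 < η) :
    |x * y - x' * y'| ≤ (1 + η⁻¹) * ((x - x') ^ 2 + (y - y') ^ 2) + η * (x' ^ 2 + y' ^ 2) := by
  have amgm : ∀ a b : ℝ, |a * b| ≤ η⁻¹ * a ^ 2 + η * b ^ 2 := by
    intro a b
    have h1 : η⁻¹ * a ^ 2 + η * b ^ 2 - 2 * (|a| * |b|) = η⁻¹ * (|a| - η * |b|) ^ 2 := by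
      rw [← sq_abs a, ← sq_abs b]; field_simp; ring
    have h2 : 0 ≤ η⁻¹ * (|a| - η * |b|) ^ 2 := by positivity
    have h3 : 0 ≤ |a| * |b| := by positivity
    rw [abs_mul]
    linarith
  have h0 : |(x - x') * (y - y')| ≤ (x - x') ^ 2 + (y - y') ^ 2 := by
    rw [abs_le]
    constructor <;> nlinarith [sq_nonneg ((x - x') + (y - y')), sq_nonneg ((x - x') - (y - y')),
      sq_nonneg (x - x'), sq_nonneg (y - y')]
  have h1 := amgm (x - x') y'
  have h2 := amgm (y - y') x'
  have e : x * y - x' * y' = (x - x') * (y - y') + (x - x') * y' + (y - y') * x' := by ring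
  rw [e]
  refine (abs_add_le _ _).trans ((add_le_add_left (abs_add_le _ _) _).trans ?_)
  linarith

/-- Perturbation of a sum of products of linear forms, bounded through the Hilbert-Schmidt norms of
the coefficient arrays; the parameter `η` comes from the inequality of arithmetic and geometric
means. -/
lemma integral_abs_sum_mul_sub_le (hL2 : ∀ j, MemLp (W j) 2 P)
    (horth : ∀ i j, ∫ ω, W i ω * W j ω ∂P = if i = j then v else 0) (n : ℕ)
    (a b a' b' : ℕ → ℕ → ℝ) {η : ℝ} (hη : 0 < η) :
    ∫ ω, |∑ i ∈ Finset.range n, (∑ j ∈ Finset.range n, a i j * W j ω) *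
          (∑ j ∈ Finset.range n, b i j * W j ω)
        - ∑ i ∈ Finset.range n, (∑ j ∈ Finset.range n, a' i j * W j ω) *
          (∑ j ∈ Finset.range n, b' i j * W j ω)| ∂P
      ≤ v * ((1 + η⁻¹) * (∑ i ∈ Finset.range n, ∑ j ∈ Finset.range n, (a i j - a' i j) ^ 2
          + ∑ i ∈ Finset.range n, ∑ j ∈ Finset.range n, (b i j - b' i j) ^ 2)
        + η * (∑ i ∈ Finset.range n, ∑ j ∈ Finset.range n, a' i j ^ 2
          + ∑ i ∈ Finset.range n, ∑ j ∈ Finset.range n, b' i j ^ 2)) := by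
  set L : (ℕ → ℝ) → Ω → ℝ := fun c ω => ∑ j ∈ Finset.range n, c j * W j ω with hLdef
  have hL : ∀ c, MemLp (L c) 2 P := memLp_weighted_sum hL2 n
  have hsq : ∀ c, Integrable (fun ω => L c ω ^ 2) P := fun c => (hL c).integrable_sq
  have hsub : ∀ c d ω, L c ω - L d ω = L (fun j => c j - d j) ω := by
    intro c d ω
    simp only [hLdef, ← Finset.sum_sub_distrib, sub_mul]
  have hval : ∀ c, ∫ ω, L c ω ^ 2 ∂P = v * ∑ j ∈ Finset.range n, c j ^ 2 :=
    integral_weighted_sum_sq hL2 horth n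
  have hmul : ∀ c d, Integrable (fun ω => L c ω * L d ω) P := fun c d =>
    (hL c).integrable_mul (hL d)
  have hadd : ∀ c d, Integrable (fun ω => L c ω ^ 2 + L d ω ^ 2) P := fun c d =>
    (hsq c).add (hsq d)
  have hbi : ∀ i, Integrable (fun ω => (1 + η⁻¹) * (L (fun j => a i j - a' i j) ω ^ 2
        + L (fun j => b i j - b' i j) ω ^ 2) + η * (L (a' i) ω ^ 2 + L (b' i) ω ^ 2)) P := fun i =>
    ((hadd _ _).const_mul _).add ((hadd _ _).const_mul _)
  have hle : ∀ ω, |∑ i ∈ Finset.range n, L (a i) ω * L (b i) ω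
        - ∑ i ∈ Finset.range n, L (a' i) ω * L (b' i) ω|
      ≤ ∑ i ∈ Finset.range n, ((1 + η⁻¹) * (L (fun j => a i j - a' i j) ω ^ 2
        + L (fun j => b i j - b' i j) ω ^ 2) + η * (L (a' i) ω ^ 2 + L (b' i) ω ^ 2)) := by
    intro ω
    rw [← Finset.sum_sub_distrib]
    refine (Finset.abs_sum_le_sum_abs _ _).trans (Finset.sum_le_sum fun i _ => ?_)
    rw [← hsub, ← hsub]
    exact abs_mul_sub_mul_le hη
  refine (integral_mono ?_ (integrable_finsetSum _ fun i _ => hbi i) hle).trans_eq ?_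
  · exact ((integrable_finsetSum _ fun i _ => hmul _ _).sub
      (integrable_finsetSum _ fun i _ => hmul _ _)).abs
  · rw [integral_finsetSum _ fun i _ => hbi i]
    have : ∀ i, ∫ ω, ((1 + η⁻¹) * (L (fun j => a i j - a' i j) ω ^ 2
        + L (fun j => b i j - b' i j) ω ^ 2) + η * (L (a' i) ω ^ 2 + L (b' i) ω ^ 2)) ∂P
        = v * ((1 + η⁻¹) * (∑ j ∈ Finset.range n, (a i j - a' i j) ^ 2
          + ∑ j ∈ Finset.range n, (b i j - b' i j) ^ 2)
        + η * (∑ j ∈ Finset.range n, a' i j ^ 2 + ∑ j ∈ Finset.range n, b' i j ^ 2)) := by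
      intro i
      rw [integral_add ((hadd _ _).const_mul _) ((hadd _ _).const_mul _),
        integral_const_mul, integral_const_mul, integral_add (hsq _) (hsq _),
        integral_add (hsq _) (hsq _), hval, hval, hval, hval]
      ring
    simp_rw [this]
    rw [← Finset.mul_sum, Finset.sum_add_distrib, ← Finset.mul_sum, ← Finset.mul_sum,
      Finset.sum_add_distrib, Finset.sum_add_distrib]

end Orthogonal

/-! ### Asymptotically degenerate bilinear functionals -/

lemma tendsto_zero_of_forall_le_mul_add {F e : ℕ → ℝ} {C : ℝ} (hF : ∀ n, 0 ≤ F n)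
    (he : Tendsto e atTop (𝓝 0))
    (h : ∀ η > 0, ∀ᶠ n in atTop, F n ≤ (1 + η⁻¹) * e n + η * C) : Tendsto F atTop (𝓝 0) := by
  rw [Metric.tendsto_atTop']
  intro ε hε
  have hη : 0 < ε / (2 * (|C| + 1)) := by positivity
  have h1 : ∀ᶠ n in atTop, (1 + (ε / (2 * (|C| + 1)))⁻¹) * e n < ε / 2 := by
    refine Tendsto.eventually_lt_const (v := 0) (by positivity) ?_
    simpa using he.const_mul (1 + (ε / (2 * (|C| + 1)))⁻¹)
  obtain ⟨N, hN⟩ := eventually_atTop.1 ((h _ hη).and h1)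
  refine ⟨N, fun n hn => ?_⟩
  obtain ⟨h2, h3⟩ := hN n hn.le
  rw [dist_zero_right, Real.norm_eq_abs, abs_of_nonneg (hF n)]
  have h4 : ε / (2 * (|C| + 1)) * C ≤ ε / 2 := by
    rw [div_mul_eq_mul_div, div_le_div_iff₀ (by positivity) (by positivity)]
    nlinarith [le_abs_self C]
  linarith

section Orthogonal

variable {Ω : Type*} [MeasurableSpace Ω] {P : Measure Ω} {W : ℕ → Ω → ℝ} {v : ℝ}

lemma tendsto_integral_abs_sum_mul_sub (hL2 : ∀ j, MemLp (W j) 2 P)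
    (horth : ∀ i j, ∫ ω, W i ω * W j ω ∂P = if i = j then v else 0)
    {a b a' b' : ℕ → ℕ → ℕ → ℝ} {C : ℝ}
    (ha : Tendsto (fun n => ∑ i ∈ Finset.range n, ∑ j ∈ Finset.range n,
      (a n i j - a' n i j) ^ 2) atTop (𝓝 0))
    (hb : Tendsto (fun n => ∑ i ∈ Finset.range n, ∑ j ∈ Finset.range n,
      (b n i j - b' n i j) ^ 2) atTop (𝓝 0))
    (hC : ∀ᶠ n in atTop, ∑ i ∈ Finset.range n, ∑ j ∈ Finset.range n, a' n i j ^ 2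
      + ∑ i ∈ Finset.range n, ∑ j ∈ Finset.range n, b' n i j ^ 2 ≤ C) :
    Tendsto (fun n => ∫ ω, |∑ i ∈ Finset.range n, (∑ j ∈ Finset.range n, a n i j * W j ω) *
          (∑ j ∈ Finset.range n, b n i j * W j ω)
        - ∑ i ∈ Finset.range n, (∑ j ∈ Finset.range n, a' n i j * W j ω) *
          (∑ j ∈ Finset.range n, b' n i j * W j ω)| ∂P) atTop (𝓝 0) := by
  have hv : 0 ≤ v := by
    have := horth 0 0
    rw [if_pos rfl] at this
    rw [← this]
    exact integral_nonneg fun ω => mul_self_nonneg _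
  have he := (ha.add hb).const_mul v
  rw [add_zero, mul_zero] at he
  refine tendsto_zero_of_forall_le_mul_add (C := v * C)
    (fun n => integral_nonneg fun ω => abs_nonneg _) he fun η hη => ?_
  filter_upwards [hC] with n hn
  refine (integral_abs_sum_mul_sub_le hL2 horth n _ _ _ _ hη).trans ?_
  rw [mul_add]
  refine add_le_add (le_of_eq (by ring)) ?_
  calc _ ≤ v * (η * C) := by gcongr
    _ = _ := by ring

/-- If the array `a` is asymptotically `u ⊗ w` and `b` is asymptotically `s ⊗ w + s' ⊗ w'`, then
the sum of the products of the associated linear forms is asymptotically `κ T ^ 2 + κ' T S`, where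
`T` and `S` are the linear forms with coefficients `w` and `w'`. -/
lemma tendsto_integral_abs_sum_mul_sub_quadratic (hL2 : ∀ j, MemLp (W j) 2 P)
    (horth : ∀ i j, ∫ ω, W i ω * W j ω ∂P = if i = j then v else 0)
    {a b : ℕ → ℕ → ℕ → ℝ} {w w' u s s' : ℕ → ℕ → ℝ} {p r l m m' κ κ' : ℝ}
    (hp : Tendsto (fun n => ∑ j ∈ Finset.range n, w n j ^ 2) atTop (𝓝 p))
    (hr : Tendsto (fun n => ∑ j ∈ Finset.range n, w' n j ^ 2) atTop (𝓝 r))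
    (hu : Tendsto (fun n => ∑ i ∈ Finset.range n, u n i ^ 2) atTop (𝓝 l))
    (hs : Tendsto (fun n => ∑ i ∈ Finset.range n, s n i ^ 2) atTop (𝓝 m))
    (hs' : Tendsto (fun n => ∑ i ∈ Finset.range n, s' n i ^ 2) atTop (𝓝 m'))
    (hus : Tendsto (fun n => ∑ i ∈ Finset.range n, u n i * s n i) atTop (𝓝 κ))
    (hus' : Tendsto (fun n => ∑ i ∈ Finset.range n, u n i * s' n i) atTop (𝓝 κ'))
    (ha : Tendsto (fun n => ∑ i ∈ Finset.range n, ∑ j ∈ Finset.range n,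
      (a n i j - u n i * w n j) ^ 2) atTop (𝓝 0))
    (hb : Tendsto (fun n => ∑ i ∈ Finset.range n, ∑ j ∈ Finset.range n,
      (b n i j - (s n i * w n j + s' n i * w' n j)) ^ 2) atTop (𝓝 0)) :
    Tendsto (fun n => ∫ ω, |∑ i ∈ Finset.range n, (∑ j ∈ Finset.range n, a n i j * W j ω) *
          (∑ j ∈ Finset.range n, b n i j * W j ω)
        - (κ * (∑ j ∈ Finset.range n, w n j * W j ω) ^ 2
          + κ' * ((∑ j ∈ Finset.range n, w n j * W j ω) *
            (∑ j ∈ Finset.range n, w' n j * W j ω)))| ∂P) atTop (𝓝 0) := by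
  have hL : ∀ n (c : ℕ → ℝ), MemLp (fun ω => ∑ j ∈ Finset.range n, c j * W j ω) 2 P :=
    fun n c => memLp_weighted_sum hL2 n c
  have hmul : ∀ n (c d : ℕ → ℝ), Integrable (fun ω => (∑ j ∈ Finset.range n, c j * W j ω) *
      (∑ j ∈ Finset.range n, d j * W j ω)) P := fun n c d => (hL n c).integrable_mul (hL n d)
  have hsqi : ∀ n (c : ℕ → ℝ), Integrable (fun ω => (∑ j ∈ Finset.range n, c j * W j ω) ^ 2) P :=
    fun n c => (hL n c).integrable_sq
  have hprod : ∀ n (x y : ℕ → ℝ), ∑ i ∈ Finset.range n, ∑ j ∈ Finset.range n, (x i * y j) ^ 2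
      = (∑ i ∈ Finset.range n, x i ^ 2) * ∑ j ∈ Finset.range n, y j ^ 2 := by
    intro n x y
    simp_rw [mul_pow, Finset.sum_mul_sum]
  have hbd : ∃ C, ∀ᶠ n in atTop,
      ∑ i ∈ Finset.range n, ∑ j ∈ Finset.range n, (u n i * w n j) ^ 2
      + ∑ i ∈ Finset.range n, ∑ j ∈ Finset.range n,
        (s n i * w n j + s' n i * w' n j) ^ 2 ≤ C := by
    have hlim := (hu.mul hp).add (((hs.mul hp).add (hs'.mul hr)).const_mul 2)
    refine ⟨_, (hlim.eventually_le_const (lt_add_one _)).mono fun n hn => le_trans ?_ hn⟩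
    rw [hprod]
    refine add_le_add le_rfl ?_
    rw [← hprod, ← hprod, ← Finset.sum_add_distrib, Finset.mul_sum]
    refine Finset.sum_le_sum fun i _ => ?_
    rw [← Finset.sum_add_distrib, Finset.mul_sum]
    exact Finset.sum_le_sum fun j _ => add_sq_le
  obtain ⟨C, hC⟩ := hbd
  have h1 := tendsto_integral_abs_sum_mul_sub hL2 horth ha hb hC
  have h2 : Tendsto (fun n => |∑ i ∈ Finset.range n, u n i * s n i - κ|
        * (v * ∑ j ∈ Finset.range n, w n j ^ 2)
      + |∑ i ∈ Finset.range n, u n i * s' n i - κ'|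
        * (v * ∑ j ∈ Finset.range n, w n j ^ 2 + v * ∑ j ∈ Finset.range n, w' n j ^ 2))
      atTop (𝓝 0) := by
    have e1 := (hus.sub_const κ).abs
    have e2 := (hus'.sub_const κ').abs
    rw [sub_self, abs_zero] at e1 e2
    simpa using (e1.mul (hp.const_mul v)).add
      (e2.mul ((hp.const_mul v).add (hr.const_mul v)))
  have h3 := h1.add h2
  rw [add_zero] at h3
  refine tendsto_of_tendsto_of_tendsto_of_le_of_le tendsto_const_nhds h3
    (fun n => integral_nonneg fun ω => abs_nonneg _) fun n => ?_
  set A : Ω → ℝ := fun ω => ∑ i ∈ Finset.range n, (∑ j ∈ Finset.range n, a n i j * W j ω) *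
          (∑ j ∈ Finset.range n, b n i j * W j ω) with hA
  set T : Ω → ℝ := fun ω => ∑ j ∈ Finset.range n, w n j * W j ω with hT
  set S : Ω → ℝ := fun ω => ∑ j ∈ Finset.range n, w' n j * W j ω with hS
  set x := ∑ i ∈ Finset.range n, u n i * s n i with hx
  set y := ∑ i ∈ Finset.range n, u n i * s' n i with hy
  have hA' : ∀ ω, ∑ i ∈ Finset.range n, (∑ j ∈ Finset.range n, (u n i * w n j) * W j ω) *
          (∑ j ∈ Finset.range n, (s n i * w n j + s' n i * w' n j) * W j ω)
        = x * T ω ^ 2 + y * (T ω * S ω) := by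
    intro ω
    rw [hx, hy, Finset.sum_mul, Finset.sum_mul, ← Finset.sum_add_distrib]
    refine Finset.sum_congr rfl fun i _ => ?_
    simp_rw [add_mul, Finset.sum_add_distrib, mul_assoc, ← Finset.mul_sum]
    ring
  have hTS : Integrable (fun ω => T ω ^ 2 + S ω ^ 2) P := (hsqi n _).add (hsqi n _)
  have hle : ∀ ω, |A ω - (κ * T ω ^ 2 + κ' * (T ω * S ω))|
      ≤ |A ω - (x * T ω ^ 2 + y * (T ω * S ω))|
        + (|x - κ| * T ω ^ 2 + |y - κ'| * (T ω ^ 2 + S ω ^ 2)) := by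
    intro ω
    have e : A ω - (κ * T ω ^ 2 + κ' * (T ω * S ω)) = (A ω - (x * T ω ^ 2 + y * (T ω * S ω)))
        + ((x - κ) * T ω ^ 2 + (y - κ') * (T ω * S ω)) := by ring
    rw [e]
    refine (abs_add_le _ _).trans (add_le_add le_rfl ((abs_add_le _ _).trans ?_))
    rw [abs_mul, abs_mul, abs_of_nonneg (sq_nonneg (T ω))]
    refine add_le_add le_rfl (mul_le_mul_of_nonneg_left ?_ (abs_nonneg _))
    rw [abs_le]
    constructor <;> nlinarith [sq_nonneg (T ω + S ω), sq_nonneg (T ω - S ω), sq_nonneg (T ω),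
      sq_nonneg (S ω)]
  have hAi : Integrable A P := integrable_finsetSum _ fun i _ => hmul n _ _
  have hQi : ∀ x y : ℝ, Integrable (fun ω => x * T ω ^ 2 + y * (T ω * S ω)) P := fun x y =>
    ((hsqi n _).const_mul _).add ((hmul n _ _).const_mul _)
  have hI1 : Integrable (fun ω => |A ω - (x * T ω ^ 2 + y * (T ω * S ω))|) P :=
    (hAi.sub (hQi x y)).abs
  have hI2 : Integrable (fun ω => |x - κ| * T ω ^ 2) P := (hsqi n _).const_mul _
  have hI3 : Integrable (fun ω => |y - κ'| * (T ω ^ 2 + S ω ^ 2)) P := hTS.const_mul _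
  have hI4 : Integrable (fun ω => |x - κ| * T ω ^ 2 + |y - κ'| * (T ω ^ 2 + S ω ^ 2)) P :=
    hI2.add hI3
  refine (integral_mono (hAi.sub (hQi κ κ')).abs (hI1.add hI4) hle).trans_eq ?_
  simp only [Pi.add_apply]
  rw [integral_add hI1 hI4, integral_add hI2 hI3, integral_const_mul, integral_const_mul,
    integral_add (hsqi n _) (hsqi n _), integral_weighted_sum_sq hL2 horth,
    integral_weighted_sum_sq hL2 horth]
  congr 1
  refine integral_congr_ae (Eventually.of_forall fun ω => ?_)
  simp only [hA']
  rfl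

end Orthogonal

/-- The quotient limit theorem behind all three regimes. For i.i.d. centred `W`, linear forms with
coefficient arrays `a ≈ u ⊗ w` and `b ≈ s ⊗ w + s' ⊗ w'` in Hilbert-Schmidt norm, where
`∑ u ^ 2` and `∑ u s'` have the same limit while `∑ u s → 0`, the quotient of `∑ (a W) (b W)` by
`∑ (a W) ^ 2` converges in distribution to the quotient of the Gaussian limits of `∑ w' W` and
`∑ w W`. -/
theorem tendstoInDistribution_quotient
    {Ω Ω' : Type*} [MeasurableSpace Ω] [MeasurableSpace Ω']
    {P : Measure Ω} [IsProbabilityMeasure P] {P' : Measure Ω'} [IsProbabilityMeasure P']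
    {W : ℕ → Ω → ℝ} {v : ℝ} (hindep : iIndepFun W P)
    (hident : ∀ j, IdentDistrib (W j) (W 0) P P)
    (hL2 : MemLp (W 0) 2 P) (hmean : ∫ ω, W 0 ω ∂P = 0) (hvar : ∫ ω, W 0 ω ^ 2 ∂P = v)
    {w w' : ℕ → ℕ → ℝ} {δ δ' : ℕ → ℝ} (hδ : Tendsto δ atTop (𝓝 0)) (hδ' : Tendsto δ' atTop (𝓝 0))
    (hw : ∀ᶠ n in atTop, ∀ j < n, |w n j| ≤ δ n) (hw' : ∀ᶠ n in atTop, ∀ j < n, |w' n j| ≤ δ' n)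
    {p q r : ℝ}
    (hp : Tendsto (fun n => ∑ j ∈ Finset.range n, w n j ^ 2) atTop (𝓝 p))
    (hq : Tendsto (fun n => ∑ j ∈ Finset.range n, w n j * w' n j) atTop (𝓝 q))
    (hr : Tendsto (fun n => ∑ j ∈ Finset.range n, w' n j ^ 2) atTop (𝓝 r))
    (hS : (!![v * p, v * q; v * q, v * r] : Matrix (Fin 2) (Fin 2) ℝ).PosSemidef)
    {φ ζ : Ω' → ℝ} (hφ : ∀ᵐ ω ∂P', φ ω ≠ 0)
    (hlaw : HasLaw (fun ω => !₂[φ ω, ζ ω])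
      (multivariateGaussian 0 !![v * p, v * q; v * q, v * r]) P')
    {a b : ℕ → ℕ → ℕ → ℝ} {u s s' : ℕ → ℕ → ℝ} {m m' κ : ℝ} (hκ : κ ≠ 0)
    (hu : Tendsto (fun n => ∑ i ∈ Finset.range n, u n i ^ 2) atTop (𝓝 κ))
    (hs : Tendsto (fun n => ∑ i ∈ Finset.range n, s n i ^ 2) atTop (𝓝 m))
    (hs' : Tendsto (fun n => ∑ i ∈ Finset.range n, s' n i ^ 2) atTop (𝓝 m'))
    (hus : Tendsto (fun n => ∑ i ∈ Finset.range n, u n i * s n i) atTop (𝓝 0))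
    (hus' : Tendsto (fun n => ∑ i ∈ Finset.range n, u n i * s' n i) atTop (𝓝 κ))
    (ha : Tendsto (fun n => ∑ i ∈ Finset.range n, ∑ j ∈ Finset.range n,
      (a n i j - u n i * w n j) ^ 2) atTop (𝓝 0))
    (hb : Tendsto (fun n => ∑ i ∈ Finset.range n, ∑ j ∈ Finset.range n,
      (b n i j - (s n i * w n j + s' n i * w' n j)) ^ 2) atTop (𝓝 0))
    {Z : ℕ → Ω → ℝ} (hZm : ∀ n, AEMeasurable (Z n) P)
    (hZ : ∀ᶠ n in atTop, ∀ ω,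
      ∑ i ∈ Finset.range n, (∑ j ∈ Finset.range n, a n i j * W j ω) ^ 2 ≠ 0 →
      Z n ω = (∑ i ∈ Finset.range n, (∑ j ∈ Finset.range n, a n i j * W j ω) *
          (∑ j ∈ Finset.range n, b n i j * W j ω)) /
        ∑ i ∈ Finset.range n, (∑ j ∈ Finset.range n, a n i j * W j ω) ^ 2) :
    TendstoInDistribution Z atTop (fun ω => ζ ω / φ ω) (fun _ => P) P' := by
  have hL2' : ∀ j, MemLp (W j) 2 P := fun j => (hident j).memLp_iff.2 hL2
  have horth : ∀ i j, ∫ ω, W i ω * W j ω ∂P = if i = j then v else 0 := by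
    intro i j
    split_ifs with h
    · subst h
      rw [← hvar, ← (hident i).sq.integral_eq]
      simp [sq]
    · have := (hindep.indepFun h).integral_mul_eq_mul_integral
        (hL2' i).aestronglyMeasurable (hL2' j).aestronglyMeasurable
      simp only [Pi.mul_apply] at this
      rw [this, (hident i).integral_eq, hmean, zero_mul]
  have hCLT := tendstoInDistribution_weighted_sums hindep hident hL2 hmean hvar hδ hδ' hw hw'
    hp hq hr hS hlaw
  have hL : ∀ n (c : ℕ → ℝ), MemLp (fun ω => ∑ j ∈ Finset.range n, c j * W j ω) 2 P :=
    fun n c => memLp_weighted_sum hL2' n c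
  have hmul : ∀ n (c d : ℕ → ℝ), Integrable (fun ω => (∑ j ∈ Finset.range n, c j * W j ω) *
      (∑ j ∈ Finset.range n, d j * W j ω)) P := fun n c d => (hL n c).integrable_mul (hL n d)
  have hAi : ∀ n, Integrable (fun ω => ∑ i ∈ Finset.range n,
      (∑ j ∈ Finset.range n, a n i j * W j ω) * (∑ j ∈ Finset.range n, b n i j * W j ω)) P :=
    fun n => integrable_finsetSum _ fun i _ => hmul n _ _
  have hDi : ∀ n, Integrable (fun ω => ∑ i ∈ Finset.range n,
      (∑ j ∈ Finset.range n, a n i j * W j ω) ^ 2) P :=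
    fun n => integrable_finsetSum _ fun i _ => (hL n _).integrable_sq
  have hA := tendsto_integral_abs_sum_mul_sub_quadratic hL2' horth hp hr hu hs hs' hus hus' ha hb
  have hD := tendsto_integral_abs_sum_mul_sub_quadratic (b := a) (s := u) (s' := fun _ _ => 0)
    (m' := 0) (κ := κ) (κ' := 0) hL2' horth hp hr hu hu (by simp) (by simpa [sq] using hu)
    (by simp) ha (by simpa using ha)
  refine tendstoInDistribution_div_of_integral_abs hκ hCLT hφ hZm
    (fun n => (hAi n).aemeasurable) (fun n => (hDi n).aemeasurable)
    (fun n => (hAi n).sub ((hmul n _ _).const_mul κ))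
    (fun n => (hDi n).sub ((hL n _).integrable_sq.const_mul κ)) ?_ ?_ hZ
  · simpa using hA
  · simpa [← sq] using hD

/-! ### Quotients of jointly Gaussian variables -/

lemma posSemidef_two_by_two {A B C : ℝ} (hA : 0 < A) (hdet : 0 ≤ A * C - B ^ 2) :
    (!![A, B; B, C] : Matrix (Fin 2) (Fin 2) ℝ).PosSemidef := by
  refine .of_dotProduct_mulVec_nonneg ?_ fun x => ?_
  · ext i j
    fin_cases i <;> fin_cases j <;> simp
  · have h : A * (A * x 0 ^ 2 + 2 * B * (x 0 * x 1) + C * x 1 ^ 2)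
        = (A * x 0 + B * x 1) ^ 2 + (A * C - B ^ 2) * x 1 ^ 2 := by ring
    have h2 : 0 ≤ A * (A * x 0 ^ 2 + 2 * B * (x 0 * x 1) + C * x 1 ^ 2) := by
      rw [h]; positivity
    have h3 := nonneg_of_mul_nonneg_right h2 hA
    simp only [Matrix.mulVec, dotProduct, Fin.sum_univ_two]
    simp
    linarith

lemma lintegral_abs_mul_exp_neg_mul_sq {b : ℝ} (hb : 0 < b) :
    ∫⁻ x : ℝ, ENNReal.ofReal (|x| * Real.exp (-b * x ^ 2)) = ENNReal.ofReal b⁻¹ := by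
  have h1 : ∫ x in Set.Ioi (0 : ℝ), x * Real.exp (-b * x ^ 2) = (2 * b)⁻¹ := by
    have h := integral_mul_cexp_neg_mul_sq (b := b) (by simpa using hb)
    have h' : ∀ r : ℝ, (r : ℂ) * Complex.exp (-(b : ℂ) * (r : ℂ) ^ 2)
        = ((r * Real.exp (-b * r ^ 2) : ℝ) : ℂ) := by
      intro r; push_cast; rfl
    simp_rw [h'] at h
    rw [integral_complex_ofReal] at h
    exact_mod_cast h
  have hi : Integrable fun x : ℝ => |x| * Real.exp (-b * x ^ 2) := by
    refine (integrable_mul_exp_neg_mul_sq hb).abs.congr (Eventually.of_forall fun x => ?_)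
    simp [abs_mul]
  rw [← ofReal_integral_eq_lintegral_ofReal hi (Eventually.of_forall fun x => by positivity)]
  congr 1
  have h2 := integral_comp_abs (f := fun x => x * Real.exp (-b * x ^ 2))
  simp only [sq_abs] at h2
  rw [h2, h1]
  field_simp

/-- The quotient of two independent centred Gaussian variables of equal variance, after an affine
map, has a Cauchy law. -/
lemma map_gaussian_quotient_eq_cauchyMeasure {A : ℝ≥0} (hA : A ≠ 0) (c : ℝ) {s : ℝ≥0}
    (hs : s ≠ 0) :
    ((gaussianReal 0 A).prod (gaussianReal 0 A)).map (fun p => c + s * (p.2 / p.1))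
      = cauchyMeasure c s := by
  have hA' : (0 : ℝ) < A := by positivity
  have hs' : (0 : ℝ) < s := by positivity
  have hm : Measurable fun p : ℝ × ℝ => c + s * (p.2 / p.1) := by fun_prop
  have hne : ∀ᵐ x ∂(gaussianReal 0 A), x ≠ 0 := by
    have := nullSingletonClass_gaussianReal (μ := 0) hA
    exact compl_mem_ae_iff.2 (measure_singleton 0)
  set β : ℝ → ℝ := fun z => (1 + ((z - c) / s) ^ 2) / (2 * A) with hβ
  have hβpos : ∀ z, 0 < β z := fun z => by positivity
  set G : ℝ → ℝ → ℝ≥0∞ := fun x z =>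
    ENNReal.ofReal (2 * Real.pi * A * s)⁻¹ * ENNReal.ofReal (|x| * Real.exp (-β z * x ^ 2)) with hG
  ext B hB
  rw [Measure.map_apply hm hB, Measure.prod_apply (hm hB)]
  -- Conditionally on the denominator `x`, the variable is Gaussian.
  have hslice : ∀ x : ℝ, x ≠ 0 → gaussianReal 0 A
      (Prod.mk x ⁻¹' ((fun p : ℝ × ℝ => c + s * (p.2 / p.1)) ⁻¹' B))
      = ∫⁻ z in B, gaussianPDF c (.mk ((s / x) ^ 2) (sq_nonneg _) * A) z := by
    intro x hx
    have hv : (.mk ((s / x) ^ 2) (sq_nonneg _) * A : ℝ≥0) ≠ 0 := by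
      refine mul_ne_zero (fun h => ?_) hA
      have := congrArg NNReal.toReal h
      simp [hs, hx] at this
    rw [← gaussianReal_apply c hv]
    have h1 : gaussianReal c (.mk ((s / x) ^ 2) (sq_nonneg _) * A)
        = (gaussianReal 0 A).map (fun y => s / x * y + c) := by
      have e : (fun y : ℝ => s / x * y + c) = (fun y => y + c) ∘ fun y => s / x * y := rfl
      rw [e, ← Measure.map_map (by fun_prop) (by fun_prop), gaussianReal_map_const_mul,
        gaussianReal_map_add_const]
      simp
    rw [h1, Measure.map_apply (by fun_prop) hB]
    congr 1
    ext y
    simp only [Set.mem_preimage]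
    rw [show c + s * (y / x) = s / x * y + c by ring]
  have hdens : ∀ x : ℝ, x ≠ 0 → ∀ z, gaussianPDF 0 A x *
      gaussianPDF c (.mk ((s / x) ^ 2) (sq_nonneg _) * A) z = G x z := by
    intro x hx z
    simp only [hG, gaussianPDF_def]
    rw [← ENNReal.ofReal_mul (gaussianPDFReal_nonneg _ _ _), ← ENNReal.ofReal_mul (by positivity)]
    congr 1
    simp only [gaussianPDFReal_def, NNReal.coe_mul, NNReal.coe_mk]
    have hx' : (0 : ℝ) < |x| := abs_pos.2 hx
    have e1 : √(2 * Real.pi * ((s / x) ^ 2 * A)) = s / |x| * √(2 * Real.pi * A) := by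
      rw [show 2 * Real.pi * ((s / x) ^ 2 * A) = (s / x) ^ 2 * (2 * Real.pi * A) by ring,
        Real.sqrt_mul (sq_nonneg _), Real.sqrt_sq_eq_abs, abs_div, abs_of_pos hs']
    have e2 : √(2 * Real.pi * A) * √(2 * Real.pi * A) = 2 * Real.pi * A :=
      Real.mul_self_sqrt (by positivity)
    have e3 : Real.exp (-(x - 0) ^ 2 / (2 * A)) * Real.exp (-(z - c) ^ 2 / (2 * ((s / x) ^ 2 * A)))
        = Real.exp (-β z * x ^ 2) := by
      rw [← Real.exp_add]
      congr 1
      simp only [hβ]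
      field_simp
      ring
    rw [e1, ← e3]
    have e4 : (√(2 * Real.pi * A))⁻¹ * (s / |x| * √(2 * Real.pi * A))⁻¹
        = (2 * Real.pi * A * s)⁻¹ * |x| := by
      rw [← mul_inv, show √(2 * Real.pi * A) * (s / |x| * √(2 * Real.pi * A))
        = √(2 * Real.pi * A) * √(2 * Real.pi * A) * (s / |x|) by ring, e2]
      field_simp
    linear_combination (Real.exp (-(x - 0) ^ 2 / (2 * A)) *
      Real.exp (-(z - c) ^ 2 / (2 * ((s / x) ^ 2 * A)))) * e4
  have hGm : Measurable (Function.uncurry G) := by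
    simp only [hG, hβ, Function.uncurry_def]
    fun_prop
  have hne' : ∀ᵐ x : ℝ, x ≠ 0 := compl_mem_ae_iff.2 (measure_singleton 0)
  calc _ = ∫⁻ x, (∫⁻ z in B, gaussianPDF c (.mk ((s / x) ^ 2) (sq_nonneg _) * A) z)
          ∂(gaussianReal 0 A) := by
        refine lintegral_congr_ae ?_
        filter_upwards [hne] with x hx using hslice x hx
    _ = ∫⁻ x, gaussianPDF 0 A x *
          ∫⁻ z in B, gaussianPDF c (.mk ((s / x) ^ 2) (sq_nonneg _) * A) z := by
        rw [gaussianReal_of_var_ne_zero _ hA, lintegral_withDensity_eq_lintegral_mul_non_measurable₀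
          _ (measurable_gaussianPDF _ _).aemeasurable
          (Eventually.of_forall fun x => gaussianPDF_lt_top)]
        rfl
    _ = ∫⁻ x, ∫⁻ z in B, G x z := by
        refine lintegral_congr_ae ?_
        filter_upwards [hne'] with x hx
        rw [← lintegral_const_mul _ (measurable_gaussianPDF _ _)]
        simp_rw [hdens x hx]
    _ = ∫⁻ z in B, ∫⁻ x, G x z := lintegral_lintegral_swap hGm.aemeasurable
    _ = ∫⁻ z in B, cauchyPDF c s z := by
        refine lintegral_congr fun z => ?_
        simp only [hG]
        rw [lintegral_const_mul _ (by fun_prop), lintegral_abs_mul_exp_neg_mul_sq (hβpos z),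
          ← ENNReal.ofReal_mul (by positivity), cauchyPDF_def, cauchyPDFReal_def']
        congr 1
        simp only [hβ, NNReal.coe_inv]
        field_simp
    _ = _ := by
        rw [cauchyMeasure_of_scale_ne_zero c hs, withDensity_apply _ hB]

/-- A nondegenerate centred bivariate Gaussian law is the law of `(x, c x + s y)` with `x`, `y`
independent of equal variance. -/
lemma multivariateGaussian_eq_map_prod {A B C : ℝ} (hA : 0 < A) (hdet : 0 < A * C - B ^ 2) :
    multivariateGaussian 0 (!![A, B; B, C] : Matrix (Fin 2) (Fin 2) ℝ)
      = ((gaussianReal 0 A.toNNReal).prod (gaussianReal 0 A.toNNReal)).map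
        (fun p => !₂[p.1, B / A * p.1 + √(A * C - B ^ 2) / A * p.2]) := by
  have hm : Measurable fun p : ℝ × ℝ =>
      !₂[p.1, B / A * p.1 + √(A * C - B ^ 2) / A * p.2] := by fun_prop
  have : IsProbabilityMeasure (((gaussianReal 0 A.toNNReal).prod (gaussianReal 0 A.toNNReal)).map
        (fun p => !₂[p.1, B / A * p.1 + √(A * C - B ^ 2) / A * p.2])) :=
    Measure.isProbabilityMeasure_map hm.aemeasurable
  refine Measure.ext_of_charFun (funext fun t => ?_)
  rw [charFun_multivariateGaussian (posSemidef_two_by_two hA hdet.le), charFun_apply,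
    integral_map hm.aemeasurable (by fun_prop)]
  have h1 : ∀ p : ℝ × ℝ, Complex.exp
      (inner ℝ !₂[p.1, B / A * p.1 + √(A * C - B ^ 2) / A * p.2] t * Complex.I)
      = Complex.exp ((t 0 + B / A * t 1 : ℝ) * p.1 * Complex.I) *
        Complex.exp ((√(A * C - B ^ 2) / A * t 1 : ℝ) * p.2 * Complex.I) := by
    intro p
    rw [← Complex.exp_add]
    congr 1
    simp [PiLp.inner_apply, Fin.sum_univ_two]
    ring
  simp_rw [h1]
  rw [integral_prod_mul (fun x : ℝ => Complex.exp ((t 0 + B / A * t 1 : ℝ) * x * Complex.I))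
    (fun y : ℝ => Complex.exp ((√(A * C - B ^ 2) / A * t 1 : ℝ) * y * Complex.I)),
    ← charFun_apply_real, ← charFun_apply_real, charFun_gaussianReal, charFun_gaussianReal,
    ← Complex.exp_add]
  congr 1
  have e : √(A * C - B ^ 2) ^ 2 = A * C - B ^ 2 := Real.sq_sqrt hdet.le
  simp [Matrix.mulVec, dotProduct, Fin.sum_univ_two, hA.le]
  have hA0 : (A : ℂ) ≠ 0 := by exact_mod_cast hA.ne'
  have e' : (√(A * C - B ^ 2) : ℂ) ^ 2 = A * C - B ^ 2 := by exact_mod_cast e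
  field_simp
  ring_nf
  rw [e']
  ring

lemma hasLaw_quotient_cauchyMeasure {Ω' : Type*} [MeasurableSpace Ω'] {P' : Measure Ω'}
    {A B C : ℝ} (hA : 0 < A) (hdet : 0 < A * C - B ^ 2) {φ ζ : Ω' → ℝ}
    (hlaw : HasLaw (fun ω => !₂[φ ω, ζ ω]) (multivariateGaussian 0 !![A, B; B, C]) P') :
    ∃ s : ℝ≥0, 0 < s ∧ HasLaw (fun ω => ζ ω / φ ω) (cauchyMeasure (B / A) s) P' := by
  have hspos : 0 < √(A * C - B ^ 2) / A := div_pos (Real.sqrt_pos.2 hdet) hA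
  have hA' : A.toNNReal ≠ 0 := by simpa using hA
  have hs0 : (√(A * C - B ^ 2) / A).toNNReal ≠ 0 := by simpa using hspos
  refine ⟨(√(A * C - B ^ 2) / A).toNNReal, by simpa using hspos, ?_⟩
  have hdiv : Measurable fun x : EuclideanSpace ℝ (Fin 2) => x 1 / x 0 := by fun_prop
  refine ⟨hdiv.comp_aemeasurable hlaw.aemeasurable, ?_⟩
  have h1 : P'.map (fun ω => ζ ω / φ ω)
      = (P'.map (fun ω => !₂[φ ω, ζ ω])).map (fun x => x 1 / x 0) := by
    rw [AEMeasurable.map_map_of_aemeasurable hdiv.aemeasurable hlaw.aemeasurable]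
    rfl
  rw [h1, hlaw.map_eq, multivariateGaussian_eq_map_prod hA hdet,
    Measure.map_map hdiv (by fun_prop),
    ← map_gaussian_quotient_eq_cauchyMeasure hA' (B / A) hs0]
  refine Measure.map_congr ?_
  have hne : ∀ᵐ x ∂(gaussianReal 0 A.toNNReal), x ≠ 0 := by
    have := nullSingletonClass_gaussianReal (μ := 0) hA'
    exact compl_mem_ae_iff.2 (measure_singleton 0)
  have hne2 := (Measure.quasiMeasurePreserving_fst (ν := gaussianReal 0 A.toNNReal)).ae hne
  filter_upwards [hne2] with p hp
  simp [Real.coe_toNNReal _ hspos.le]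
  field_simp

lemma ae_ne_zero_of_hasLaw {Ω' : Type*} [MeasurableSpace Ω'] {P' : Measure Ω'}
    {A B C : ℝ} (hA : 0 < A) (hdet : 0 ≤ A * C - B ^ 2) {φ ζ : Ω' → ℝ}
    (hlaw : HasLaw (fun ω => !₂[φ ω, ζ ω]) (multivariateGaussian 0 !![A, B; B, C]) P') :
    ∀ᵐ ω ∂P', φ ω ≠ 0 := by
  have h := ((measurePreserving_eval_multivariateGaussian (μ := 0) (i := 0)
    (posSemidef_two_by_two hA hdet)).hasLaw).fun_comp hlaw
  have hA' : A.toNNReal ≠ 0 := by simpa using hA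
  have := nullSingletonClass_gaussianReal (μ := 0) hA'
  refine (h.ae_iff (p := fun x => x ≠ 0) (by fun_prop)).2 ?_
  exact compl_mem_ae_iff.2 (measure_singleton (μ := gaussianReal 0 A.toNNReal) 0)

lemma hasLaw_swap {Ω' : Type*} [MeasurableSpace Ω'] {P' : Measure Ω'} [IsProbabilityMeasure P']
    {A B C : ℝ} (hA : 0 < A) (hC : 0 < C) (hdet : 0 ≤ A * C - B ^ 2) {φ ζ : Ω' → ℝ}
    (hlaw : HasLaw (fun ω => !₂[φ ω, ζ ω]) (multivariateGaussian 0 !![A, B; B, C]) P') :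
    HasLaw (fun ω => !₂[ζ ω, φ ω]) (multivariateGaussian 0 !![C, B; B, A]) P' := by
  have hm : Measurable fun x : EuclideanSpace ℝ (Fin 2) => !₂[x 1, x 0] := by fun_prop
  have hm' : AEMeasurable (fun ω => !₂[ζ ω, φ ω]) P' := hm.comp_aemeasurable hlaw.aemeasurable
  refine ⟨hm', ?_⟩
  have := Measure.isProbabilityMeasure_map hm'
  refine Measure.ext_of_charFun (funext fun t => ?_)
  have h1 : charFun (P'.map fun ω => !₂[ζ ω, φ ω]) t
      = charFun (P'.map fun ω => !₂[φ ω, ζ ω]) !₂[t 1, t 0] := by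
    rw [charFun_apply, charFun_apply, integral_map hm' (by fun_prop),
      integral_map hlaw.aemeasurable (by fun_prop)]
    congr 1 with ω
    congr 3
    simp [PiLp.inner_apply, Fin.sum_univ_two, add_comm]
  rw [h1, hlaw.map_eq, charFun_multivariateGaussian (posSemidef_two_by_two hA hdet),
    charFun_multivariateGaussian (posSemidef_two_by_two hC (by linarith))]
  congr 1
  simp [Matrix.mulVec, dotProduct, Fin.sum_univ_two]
  ring

/-! ### Geometric sums with ratio near one -/

lemma sub_one_mul_sum_inv_pow {q : ℝ} (hq : q ≠ 0) (n : ℕ) :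
    (q - 1) * ∑ j ∈ Finset.range n, q⁻¹ ^ (j + 1) = 1 - q⁻¹ ^ n := by
  induction n with
  | zero => simp
  | succ n ih =>
    rw [Finset.sum_range_succ, mul_add, ih, pow_succ]
    field_simp
    ring

lemma sub_one_mul_sum_mul_inv_pow {q : ℝ} (hq : q ≠ 0) (n : ℕ) :
    (q - 1) * ∑ j ∈ Finset.range n, ((j : ℝ) + 1) * q⁻¹ ^ (j + 1)
      = 1 + ∑ j ∈ Finset.range n, q⁻¹ ^ (j + 1) - (n + 1) * q⁻¹ ^ n := by
  induction n with
  | zero => simp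
  | succ n ih =>
    rw [Finset.sum_range_succ, mul_add, ih, Finset.sum_range_succ, pow_succ]
    push_cast
    field_simp
    ring

lemma sub_one_mul_sum_sq_mul_inv_pow {q : ℝ} (hq : q ≠ 0) (n : ℕ) :
    (q - 1) * ∑ j ∈ Finset.range n, ((j : ℝ) + 1) ^ 2 * q⁻¹ ^ (j + 1)
      = 1 + 2 * ∑ j ∈ Finset.range n, ((j : ℝ) + 1) * q⁻¹ ^ (j + 1)
        + ∑ j ∈ Finset.range n, q⁻¹ ^ (j + 1) - (n + 1) ^ 2 * q⁻¹ ^ n := by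
  induction n with
  | zero => simp
  | succ n ih =>
    rw [Finset.sum_range_succ, mul_add, ih, Finset.sum_range_succ, Finset.sum_range_succ, pow_succ]
    push_cast
    linear_combination ((n : ℝ) + 1) ^ 2 * q⁻¹ ^ n * mul_inv_cancel₀ hq

lemma exp_half_le_one_add {x : ℝ} (h0 : 0 ≤ x) (h1 : x ≤ 1) : Real.exp (x / 2) ≤ 1 + x := by
  have h := Real.one_sub_le_exp_neg (x / 2)
  rw [Real.exp_neg] at h
  have hp := Real.exp_pos (x / 2)
  have h2 : (1 - x / 2) * Real.exp (x / 2) ≤ 1 := by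
    calc _ ≤ (Real.exp (x / 2))⁻¹ * Real.exp (x / 2) := by gcongr
      _ = 1 := inv_mul_cancel₀ hp.ne'
  nlinarith

section NearOne

variable {k q : ℕ → ℝ} {g : ℝ}

lemma tendsto_one_of_tendsto_mul_sub_one (hk : Tendsto k atTop atTop)
    (hq : Tendsto (fun n => k n * (q n - 1)) atTop (𝓝 g)) : Tendsto q atTop (𝓝 1) := by
  have h := (hq.mul (tendsto_inv_atTop_zero.comp hk)).add_const 1
  rw [mul_zero, zero_add] at h
  refine h.congr' ?_
  filter_upwards [hk.eventually_gt_atTop 0] with n hn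
  simp only [Function.comp]
  field_simp
  ring

lemma eventually_one_lt_of_tendsto_mul_sub_one (hk : Tendsto k atTop atTop) (hg : 0 < g)
    (hq : Tendsto (fun n => k n * (q n - 1)) atTop (𝓝 g)) : ∀ᶠ n in atTop, 1 < q n := by
  filter_upwards [hk.eventually_gt_atTop 0, hq.eventually_const_lt hg] with n h1 h2
  have := pos_of_mul_pos_right h2 h1.le
  linarith

/-- `q ^ n` grows exponentially in `n / k`. -/
lemma tendsto_pow_mul_inv_pow (hk : Tendsto k atTop atTop)
    (ht : Tendsto (fun n : ℕ => (n : ℝ) / k n) atTop atTop) (hg : 0 < g)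
    (hq : Tendsto (fun n => k n * (q n - 1)) atTop (𝓝 g)) (m : ℕ) :
    Tendsto (fun n : ℕ => ((n : ℝ) / k n) ^ m * (q n)⁻¹ ^ n) atTop (𝓝 0) := by
  have hlim : Tendsto (fun n : ℕ => (4 / g) ^ m * ((g / 4 * ((n : ℝ) / k n)) ^ m *
      Real.exp (-(g / 4 * ((n : ℝ) / k n))))) atTop (𝓝 0) := by
    have := (Real.tendsto_pow_mul_exp_neg_atTop_nhds_zero m).comp
      (ht.const_mul_atTop (show 0 < g / 4 by positivity))
    simpa using this.const_mul ((4 / g) ^ m)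
  refine tendsto_of_tendsto_of_tendsto_of_le_of_le' tendsto_const_nhds hlim ?_ ?_
  · filter_upwards [hk.eventually_gt_atTop 0, eventually_one_lt_of_tendsto_mul_sub_one hk hg hq]
      with n h1 h2
    positivity
  · filter_upwards [hk.eventually_gt_atTop 0, hk.eventually_ge_atTop (g / 2),
      hq.eventually_const_lt (show g / 2 < g by linarith)] with n h1 h2 h3
    have hx1 : g / 2 / k n ≤ 1 := (div_le_one h1).2 h2
    have hqle : 1 + g / 2 / k n ≤ q n := by
      have : g / 2 / k n ≤ q n - 1 := by rw [div_le_iff₀ h1]; linarith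
      linarith
    have hexp : Real.exp (g / 4 * ((n : ℝ) / k n)) ≤ q n ^ n := by
      calc Real.exp (g / 4 * ((n : ℝ) / k n)) = Real.exp (g / 2 / k n / 2) ^ n := by
            rw [← Real.exp_nat_mul]; congr 1; ring
        _ ≤ q n ^ n := by
            gcongr
            exact (exp_half_le_one_add (by positivity) hx1).trans hqle
    have e : (4 / g) ^ m * ((g / 4 * ((n : ℝ) / k n)) ^ m *
        Real.exp (-(g / 4 * ((n : ℝ) / k n))))
        = ((n : ℝ) / k n) ^ m * Real.exp (-(g / 4 * ((n : ℝ) / k n))) := by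
      rw [← mul_assoc, ← mul_pow]
      congr 2
      field_simp
    rw [e, Real.exp_neg, inv_pow]
    gcongr

lemma tendsto_sum_inv_pow_succ_div (hk : Tendsto k atTop atTop)
    (ht : Tendsto (fun n : ℕ => (n : ℝ) / k n) atTop atTop) (hg : 0 < g)
    (hq : Tendsto (fun n => k n * (q n - 1)) atTop (𝓝 g)) :
    Tendsto (fun n => (∑ j ∈ Finset.range n, (q n)⁻¹ ^ (j + 1)) / k n) atTop (𝓝 (1 / g)) := by
  have h0 := tendsto_pow_mul_inv_pow hk ht hg hq 0
  simp only [pow_zero, one_mul] at h0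
  have h := (h0.const_sub 1).div hq hg.ne'
  rw [sub_zero] at h
  refine h.congr' ?_
  filter_upwards [hk.eventually_gt_atTop 0, eventually_one_lt_of_tendsto_mul_sub_one hk hg hq]
    with n h1 h2
  have h3 : q n - 1 ≠ 0 := by linarith
  simp only [Pi.div_apply]
  rw [← sub_one_mul_sum_inv_pow (by linarith) n]
  field_simp

lemma tendsto_sum_mul_inv_pow_succ_div (hk : Tendsto k atTop atTop)
    (ht : Tendsto (fun n : ℕ => (n : ℝ) / k n) atTop atTop) (hg : 0 < g)
    (hq : Tendsto (fun n => k n * (q n - 1)) atTop (𝓝 g)) :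
    Tendsto (fun n => (∑ j ∈ Finset.range n, ((j : ℝ) + 1) * (q n)⁻¹ ^ (j + 1)) / k n ^ 2) atTop
      (𝓝 (1 / g ^ 2)) := by
  have hi : Tendsto (fun n => (k n)⁻¹) atTop (𝓝 0) := tendsto_inv_atTop_zero.comp hk
  have h0 := tendsto_pow_mul_inv_pow hk ht hg hq 0
  simp only [pow_zero, one_mul] at h0
  have h1 := tendsto_pow_mul_inv_pow hk ht hg hq 1
  have h := (((hi.add (tendsto_sum_inv_pow_succ_div hk ht hg hq)).sub h1).sub
    (hi.mul h0)).div hq hg.ne'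
  have e : (0 + 1 / g - 0 - 0 * 0) / g = 1 / g ^ 2 := by field_simp; ring
  rw [e] at h
  refine h.congr' ?_
  filter_upwards [hk.eventually_gt_atTop 0, eventually_one_lt_of_tendsto_mul_sub_one hk hg hq]
    with n h1 h2
  have h3 : q n - 1 ≠ 0 := by linarith
  have h4 := sub_one_mul_sum_mul_inv_pow (q := q n) (by linarith) n
  rw [mul_comm, ← eq_div_iff h3] at h4
  simp only [Pi.div_apply]
  rw [h4]
  generalize ∑ j ∈ Finset.range n, (q n)⁻¹ ^ (j + 1) = y
  generalize (q n)⁻¹ ^ n = z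
  field_simp
  ring

lemma tendsto_sum_sq_mul_inv_pow_succ_div (hk : Tendsto k atTop atTop)
    (ht : Tendsto (fun n : ℕ => (n : ℝ) / k n) atTop atTop) (hg : 0 < g)
    (hq : Tendsto (fun n => k n * (q n - 1)) atTop (𝓝 g)) :
    Tendsto (fun n => (∑ j ∈ Finset.range n, ((j : ℝ) + 1) ^ 2 * (q n)⁻¹ ^ (j + 1)) / k n ^ 3)
      atTop (𝓝 (2 / g ^ 3)) := by
  have hi : Tendsto (fun n => (k n)⁻¹) atTop (𝓝 0) := tendsto_inv_atTop_zero.comp hk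
  have h0 := tendsto_pow_mul_inv_pow hk ht hg hq 0
  simp only [pow_zero, one_mul] at h0
  have h1 := tendsto_pow_mul_inv_pow hk ht hg hq 1
  have h2 := tendsto_pow_mul_inv_pow hk ht hg hq 2
  have h := ((((((hi.pow 2).add ((tendsto_sum_mul_inv_pow_succ_div hk ht hg hq).const_mul 2)).add
    (hi.mul (tendsto_sum_inv_pow_succ_div hk ht hg hq))).sub h2).sub
    ((hi.mul h1).const_mul 2)).sub ((hi.pow 2).mul h0)).div hq hg.ne'
  have e : (0 ^ 2 + 2 * (1 / g ^ 2) + 0 * (1 / g) - 0 - 2 * (0 * 0) - 0 ^ 2 * 0) / g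
      = 2 / g ^ 3 := by field_simp; ring
  rw [e] at h
  refine h.congr' ?_
  filter_upwards [hk.eventually_gt_atTop 0, eventually_one_lt_of_tendsto_mul_sub_one hk hg hq]
    with n h1 h2
  have h3 : q n - 1 ≠ 0 := by linarith
  have h4 := sub_one_mul_sum_sq_mul_inv_pow (q := q n) (by linarith) n
  rw [mul_comm, ← eq_div_iff h3] at h4
  simp only [Pi.div_apply]
  rw [h4]
  generalize ∑ j ∈ Finset.range n, ((j : ℝ) + 1) * (q n)⁻¹ ^ (j + 1) = x
  generalize ∑ j ∈ Finset.range n, (q n)⁻¹ ^ (j + 1) = y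
  generalize (q n)⁻¹ ^ n = z
  field_simp
  ring

lemma tendsto_sum_inv_pow_div (hk : Tendsto k atTop atTop)
    (ht : Tendsto (fun n : ℕ => (n : ℝ) / k n) atTop atTop) (hg : 0 < g)
    (hq : Tendsto (fun n => k n * (q n - 1)) atTop (𝓝 g)) :
    Tendsto (fun n => (∑ j ∈ Finset.range n, (q n)⁻¹ ^ j) / k n) atTop (𝓝 (1 / g)) := by
  have h := (tendsto_one_of_tendsto_mul_sub_one hk hq).mul
    (tendsto_sum_inv_pow_succ_div hk ht hg hq)
  rw [one_mul] at h
  refine h.congr' ?_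
  filter_upwards [eventually_one_lt_of_tendsto_mul_sub_one hk hg hq] with n h2
  have h3 : q n ≠ 0 := by linarith
  rw [← mul_div_assoc, Finset.mul_sum]
  congr 1
  refine Finset.sum_congr rfl fun j _ => ?_
  rw [pow_succ]
  field_simp

lemma tendsto_sum_mul_inv_pow_div (hk : Tendsto k atTop atTop)
    (ht : Tendsto (fun n : ℕ => (n : ℝ) / k n) atTop atTop) (hg : 0 < g)
    (hq : Tendsto (fun n => k n * (q n - 1)) atTop (𝓝 g)) :
    Tendsto (fun n => (∑ j ∈ Finset.range n, (j : ℝ) * (q n)⁻¹ ^ j) / k n ^ 2) atTop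
      (𝓝 (1 / g ^ 2)) := by
  have hi : Tendsto (fun n => (k n)⁻¹) atTop (𝓝 0) := tendsto_inv_atTop_zero.comp hk
  have h := (tendsto_one_of_tendsto_mul_sub_one hk hq).mul
    ((tendsto_sum_mul_inv_pow_succ_div hk ht hg hq).sub
      (hi.mul (tendsto_sum_inv_pow_succ_div hk ht hg hq)))
  rw [zero_mul, sub_zero, one_mul] at h
  refine h.congr' ?_
  filter_upwards [hk.eventually_gt_atTop 0, eventually_one_lt_of_tendsto_mul_sub_one hk hg hq]
    with n h1 h2
  have h3 : q n ≠ 0 := by linarith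
  have e : ∑ j ∈ Finset.range n, (j : ℝ) * (q n)⁻¹ ^ j
      = q n * (∑ j ∈ Finset.range n, ((j : ℝ) + 1) * (q n)⁻¹ ^ (j + 1)
        - ∑ j ∈ Finset.range n, (q n)⁻¹ ^ (j + 1)) := by
    rw [← Finset.sum_sub_distrib, Finset.mul_sum]
    refine Finset.sum_congr rfl fun j _ => ?_
    rw [pow_succ]
    field_simp
    ring
  rw [e]
  field_simp

lemma tendsto_sum_sq_mul_inv_pow_div (hk : Tendsto k atTop atTop)
    (ht : Tendsto (fun n : ℕ => (n : ℝ) / k n) atTop atTop) (hg : 0 < g)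
    (hq : Tendsto (fun n => k n * (q n - 1)) atTop (𝓝 g)) :
    Tendsto (fun n => (∑ j ∈ Finset.range n, (j : ℝ) ^ 2 * (q n)⁻¹ ^ j) / k n ^ 3) atTop
      (𝓝 (2 / g ^ 3)) := by
  have hi : Tendsto (fun n => (k n)⁻¹) atTop (𝓝 0) := tendsto_inv_atTop_zero.comp hk
  have h := (tendsto_one_of_tendsto_mul_sub_one hk hq).mul
    (((tendsto_sum_sq_mul_inv_pow_succ_div hk ht hg hq).sub
      ((hi.mul (tendsto_sum_mul_inv_pow_succ_div hk ht hg hq)).const_mul 2)).add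
      ((hi.pow 2).mul (tendsto_sum_inv_pow_succ_div hk ht hg hq)))
  have e : 1 * (2 / g ^ 3 - 2 * (0 * (1 / g ^ 2)) + 0 ^ 2 * (1 / g)) = 2 / g ^ 3 := by ring
  rw [e] at h
  refine h.congr' ?_
  filter_upwards [hk.eventually_gt_atTop 0, eventually_one_lt_of_tendsto_mul_sub_one hk hg hq]
    with n h1 h2
  have h3 : q n ≠ 0 := by linarith
  have e : ∑ j ∈ Finset.range n, (j : ℝ) ^ 2 * (q n)⁻¹ ^ j
      = q n * (∑ j ∈ Finset.range n, ((j : ℝ) + 1) ^ 2 * (q n)⁻¹ ^ (j + 1)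
        - 2 * ∑ j ∈ Finset.range n, ((j : ℝ) + 1) * (q n)⁻¹ ^ (j + 1)
        + ∑ j ∈ Finset.range n, (q n)⁻¹ ^ (j + 1)) := by
    rw [Finset.mul_sum _ _ (2 : ℝ), ← Finset.sum_sub_distrib, ← Finset.sum_add_distrib, Finset.mul_sum]
    refine Finset.sum_congr rfl fun j _ => ?_
    rw [pow_succ]
    linear_combination -((j : ℝ) ^ 2 * (q n)⁻¹ ^ j) * mul_inv_cancel₀ h3
  rw [e]
  field_simp

lemma sum_sum_ite_pow_le {r : ℝ} (hr : 0 ≤ r) (n : ℕ) :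
    ∑ i ∈ Finset.range n, ∑ j ∈ Finset.range n, (if i ≤ j then r ^ (j - i) else 0)
      ≤ n * ∑ m ∈ Finset.range n, r ^ m := by
  have h : ∀ i ∈ Finset.range n, ∑ j ∈ Finset.range n, (if i ≤ j then r ^ (j - i) else 0)
      ≤ ∑ m ∈ Finset.range n, r ^ m := by
    intro i _
    rw [← Finset.sum_filter]
    have hinj : Set.InjOn (fun j => j - i) ((Finset.range n).filter (fun j => i ≤ j)) := by
      intro x hx y hy hxy
      simp only [Finset.coe_filter, Finset.mem_range, Set.mem_ofPred_eq] at hx hy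
      simp only at hxy
      omega
    rw [← Finset.sum_image (f := fun m => r ^ m) hinj]
    refine Finset.sum_le_sum_of_subset_of_nonneg ?_ fun m _ _ => by positivity
    intro m hm
    simp only [Finset.mem_image, Finset.mem_filter, Finset.mem_range] at hm ⊢
    omega
  refine (Finset.sum_le_sum h).trans_eq ?_
  simp

/-- The coefficients of the innovations lying in the future of the observation are negligible, even
after multiplication by a power of `n / k`. -/
lemma tendsto_future_coefficients (hk : Tendsto k atTop atTop)
    (ht : Tendsto (fun n : ℕ => (n : ℝ) / k n) atTop atTop) (hg : 0 < g)
    (hq : Tendsto (fun n => k n * (q n - 1)) atTop (𝓝 g)) (m : ℕ) :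
    Tendsto (fun n : ℕ => ((n : ℝ) / k n) ^ m * ((q n)⁻¹ ^ n * ((∑ i ∈ Finset.range n,
      ∑ j ∈ Finset.range n, (if i ≤ j then (q n)⁻¹ ^ (j - i) else 0)) / k n ^ 2)))
      atTop (𝓝 0) := by
  have h := (tendsto_pow_mul_inv_pow hk ht hg hq (m + 1)).mul
    (tendsto_sum_inv_pow_div hk ht hg hq)
  rw [zero_mul] at h
  refine tendsto_of_tendsto_of_tendsto_of_le_of_le' tendsto_const_nhds h ?_ ?_
  · filter_upwards [hk.eventually_gt_atTop 0, eventually_one_lt_of_tendsto_mul_sub_one hk hg hq]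
      with n h1 h2
    have h3 : 0 ≤ ∑ i ∈ Finset.range n,
        ∑ j ∈ Finset.range n, (if i ≤ j then (q n)⁻¹ ^ (j - i) else 0) :=
      Finset.sum_nonneg fun i _ => Finset.sum_nonneg fun j _ => by split_ifs <;> positivity
    positivity
  · filter_upwards [hk.eventually_gt_atTop 0, eventually_one_lt_of_tendsto_mul_sub_one hk hg hq]
      with n h1 h2
    calc _ ≤ ((n : ℝ) / k n) ^ m * ((q n)⁻¹ ^ n *
          ((n * ∑ j ∈ Finset.range n, (q n)⁻¹ ^ j) / k n ^ 2)) := by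
          gcongr
          exact sum_sum_ite_pow_le (by positivity) n
      _ = _ := by
          rw [pow_succ _ m]
          generalize ∑ j ∈ Finset.range n, (q n)⁻¹ ^ j = y
          generalize ((n : ℝ) / k n) ^ m = z
          field_simp

end NearOne

/-! ### The autoregressive recursions -/

lemma arError_succ_eq_sum (ρ : ℝ) (V : ℕ → ℝ) (i : ℕ) :
    arError ρ V (i + 1) = ∑ j ∈ Finset.range (i + 1), ρ ^ (i - j) * V (j + 1) := by
  induction i with
  | zero => simp [arError]
  | succ i ih =>
    rw [arError, ih, Finset.sum_range_succ _ (i + 1), Finset.mul_sum]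
    congr 1
    · refine Finset.sum_congr rfl fun j hj => ?_
      rw [Nat.succ_sub (by simp at hj; omega), pow_succ]
      ring
    · simp

lemma mul_arError_eq_sum (ρ : ℝ) (V : ℕ → ℝ) (i : ℕ) :
    ρ * arError ρ V i = ∑ j ∈ Finset.range i, ρ ^ (i - j) * V (j + 1) := by
  have h := arError_succ_eq_sum ρ V i
  rw [arError, Finset.sum_range_succ] at h
  simpa using h

/-- Away from a double root the process is a combination of the two first order processes. -/
lemma sub_mul_arProcess (θ ρ : ℝ) (V : ℕ → ℝ) (i : ℕ) :
    (θ - ρ) * arProcess θ ρ V i = θ * arError θ V i - ρ * arError ρ V i := by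
  induction i with
  | zero => simp [arProcess, arError]
  | succ i ih =>
    simp only [arProcess, arError]
    linear_combination θ * ih

/-- The two autoregressive parameters play symmetric roles. -/
lemma arProcess_comm (θ ρ : ℝ) (V : ℕ → ℝ) (i : ℕ) : arProcess θ ρ V i = arProcess ρ θ V i := by
  rcases eq_or_ne θ ρ with h | h
  · rw [h]
  · have h1 := sub_mul_arProcess θ ρ V i
    have h2 := sub_mul_arProcess ρ θ V i
    exact mul_left_cancel₀ (sub_ne_zero.2 h) (by linarith)

/-- At a double root, where the coefficients degenerate to derivatives of powers. -/
lemma mul_arProcess_self_eq_sum (θ : ℝ) (V : ℕ → ℝ) (i : ℕ) :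
    θ * arProcess θ θ V i = ∑ j ∈ Finset.range i, ((i : ℝ) - j) * θ ^ (i - j) * V (j + 1) := by
  induction i with
  | zero => simp [arProcess]
  | succ i ih =>
    rw [arProcess, ih, arError_succ_eq_sum, Finset.sum_range_succ, Finset.sum_range_succ, mul_add,
      Finset.mul_sum, mul_add, Finset.mul_sum, ← add_assoc, ← Finset.sum_add_distrib]
    congr 1
    · refine Finset.sum_congr rfl fun j hj => ?_
      rw [Nat.succ_sub (by simp at hj; omega), pow_succ]
      push_cast
      ring
    · simp

lemma sum_range_ite_lt {n i : ℕ} (hi : i ≤ n) (f : ℕ → ℝ) :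
    ∑ j ∈ Finset.range n, (if j < i then f j else 0) = ∑ j ∈ Finset.range i, f j := by
  rw [← Finset.sum_filter]
  congr 1
  ext j
  simp only [Finset.mem_filter, Finset.mem_range]
  omega

lemma lsEstimator_eq_sum_range (n : ℕ) (X : ℕ → ℝ) :
    lsEstimator n X = (∑ i ∈ Finset.range n, X (i + 1) * X i) / ∑ i ∈ Finset.range n, X i ^ 2 := by
  have h : ∀ f : ℕ → ℝ, ∑ k ∈ Finset.Icc 1 n, f k = ∑ i ∈ Finset.range n, f (i + 1) := by
    intro f
    rw [Finset.range_eq_Ico, Finset.sum_Ico_add' f 0 n 1]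
    rfl
  simp [lsEstimator, h]

lemma thetaHat_sub_eq {θ ρ : ℝ} {n : ℕ} {V : ℕ → ℝ}
    (h : ∑ i ∈ Finset.range n, arProcess θ ρ V i ^ 2 ≠ 0) :
    thetaHat θ ρ n V - θ = (∑ i ∈ Finset.range n, arProcess θ ρ V i * arError ρ V (i + 1)) /
      ∑ i ∈ Finset.range n, arProcess θ ρ V i ^ 2 := by
  rw [thetaHat, lsEstimator_eq_sum_range, eq_div_iff h, sub_mul, div_mul_cancel₀ _ h,
    Finset.mul_sum, ← Finset.sum_sub_distrib]
  refine Finset.sum_congr rfl fun i _ => ?_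
  rw [arProcess]
  ring

/-- Centred at `ρ` instead of `θ`, the estimation error is driven by the autoregressive process with
parameter `θ`. -/
lemma thetaHat_sub_eq' {θ ρ : ℝ} {n : ℕ} {V : ℕ → ℝ}
    (h : ∑ i ∈ Finset.range n, arProcess ρ θ V i ^ 2 ≠ 0) :
    thetaHat θ ρ n V - ρ = (∑ i ∈ Finset.range n, arProcess ρ θ V i * arError θ V (i + 1)) /
      ∑ i ∈ Finset.range n, arProcess ρ θ V i ^ 2 := by
  rw [← thetaHat_sub_eq h]
  simp [thetaHat, lsEstimator, arProcess_comm θ ρ]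

section Measurability

variable {Ω : Type*} [MeasurableSpace Ω] {P : Measure Ω} {V : ℕ → Ω → ℝ}

lemma aemeasurable_arError (hV : ∀ j, AEMeasurable (V (j + 1)) P) (ρ : ℝ) (i : ℕ) :
    AEMeasurable (fun ω => arError ρ (fun j => V j ω) i) P := by
  induction i with
  | zero => exact aemeasurable_const
  | succ i ih => exact (ih.const_mul ρ).add (hV i)

lemma aemeasurable_arProcess (hV : ∀ j, AEMeasurable (V (j + 1)) P) (θ ρ : ℝ) (i : ℕ) :
    AEMeasurable (fun ω => arProcess θ ρ (fun j => V j ω) i) P := by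
  induction i with
  | zero => exact aemeasurable_const
  | succ i ih => exact (ih.const_mul θ).add (aemeasurable_arError hV ρ (i + 1))

lemma aemeasurable_thetaHat (hV : ∀ j, AEMeasurable (V (j + 1)) P) (θ ρ : ℝ) (n : ℕ) :
    AEMeasurable (fun ω => thetaHat θ ρ n (fun j => V j ω)) P :=
  (Finset.aemeasurable_fun_sum _ fun i _ => (aemeasurable_arProcess hV θ ρ i).mul
    (aemeasurable_arProcess hV θ ρ (i - 1))).div
    (Finset.aemeasurable_fun_sum _ fun i _ => (aemeasurable_arProcess hV θ ρ (i - 1)).pow_const 2)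

end Measurability

/-! ### Distinct rates of explosion -/

section Ratios

variable {k p q : ℕ → ℝ} {x y : ℝ}

lemma tendsto_mul_mul_sub_one (hk : Tendsto k atTop atTop)
    (hp : Tendsto (fun n => k n * (p n - 1)) atTop (𝓝 x))
    (hq : Tendsto (fun n => k n * (q n - 1)) atTop (𝓝 y)) :
    Tendsto (fun n => k n * (p n * q n - 1)) atTop (𝓝 (x + y)) := by
  have h := (hp.mul (tendsto_one_of_tendsto_mul_sub_one hk hq)).add hq
  rw [mul_one] at h
  refine h.congr fun n => ?_
  ring

lemma tendsto_mul_div_sub_one (hk : Tendsto k atTop atTop)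
    (hp : Tendsto (fun n => k n * (p n - 1)) atTop (𝓝 x))
    (hq : Tendsto (fun n => k n * (q n - 1)) atTop (𝓝 y)) :
    Tendsto (fun n => k n * (p n / q n - 1)) atTop (𝓝 (x - y)) := by
  have hq1 := tendsto_one_of_tendsto_mul_sub_one hk hq
  have h := (hp.sub hq).div hq1 one_ne_zero
  rw [div_one] at h
  refine h.congr' ?_
  filter_upwards [hq1.eventually_ne one_ne_zero] with n hn
  simp only [Pi.div_apply]
  field_simp
  ring

end Ratios

lemma inv_pow_div_sqrt_mul_of_le {x k : ℝ} (hx : x ≠ 0) (hk : 0 < k) {i j n : ℕ} (hji : j ≤ i)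
    (hin : i < n) :
    x⁻¹ ^ (n - 1 - i) / √k * (x⁻¹ ^ (j + 1) / √k) = x ^ (i - j) * x⁻¹ ^ n / k := by
  obtain ⟨d, rfl⟩ := Nat.exists_eq_add_of_le hji
  obtain ⟨e, rfl⟩ := Nat.exists_eq_add_of_lt hin
  rw [div_mul_div_comm, Real.mul_self_sqrt hk.le, show j + d + e + 1 - 1 - (j + d) = e by omega,
    show j + d - j = d by omega]
  congr 1
  simp only [pow_add, inv_pow]
  field_simp

lemma inv_pow_div_sqrt_mul_of_ge {x k : ℝ} (hk : 0 < k) {i j n : ℕ} (hij : i ≤ j)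
    (hin : i < n) :
    x⁻¹ ^ (n - 1 - i) / √k * (x⁻¹ ^ (j + 1) / √k) = x⁻¹ ^ n * x⁻¹ ^ (j - i) / k := by
  obtain ⟨d, rfl⟩ := Nat.exists_eq_add_of_le hij
  obtain ⟨e, rfl⟩ := Nat.exists_eq_add_of_lt hin
  rw [div_mul_div_comm, Real.mul_self_sqrt hk.le, show i + e + 1 - 1 - i = e by omega,
    show i + d - i = d by omega, ← pow_add, ← pow_add]
  congr 2
  omega

lemma sum_mul_inv_pow_div_sqrt_mul {x y k : ℝ} (hk : 0 < k) (f : ℕ → ℝ) (n : ℕ) :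
    ∑ j ∈ Finset.range n, f j * (x⁻¹ ^ (j + 1) / √k * (y⁻¹ ^ (j + 1) / √k))
      = (∑ j ∈ Finset.range n, f j * (x * y)⁻¹ ^ (j + 1)) / k := by
  rw [Finset.sum_div]
  refine Finset.sum_congr rfl fun j _ => ?_
  rw [div_mul_div_comm, Real.mul_self_sqrt hk.le, mul_inv, mul_pow, mul_div_assoc (f j)]

lemma sum_inv_pow_div_sqrt_mul {x y k : ℝ} (hk : 0 < k) (n : ℕ) :
    ∑ j ∈ Finset.range n, x⁻¹ ^ (j + 1) / √k * (y⁻¹ ^ (j + 1) / √k)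
      = (∑ j ∈ Finset.range n, (x * y)⁻¹ ^ (j + 1)) / k := by
  simpa only [one_mul] using sum_mul_inv_pow_div_sqrt_mul (x := x) (y := y) hk (fun _ => 1) n

lemma sum_mul_inv_pow_reflect_div_sqrt_mul {x y k : ℝ} (hk : 0 < k) (f : ℕ → ℝ) (n : ℕ) :
    ∑ i ∈ Finset.range n, f (n - 1 - i) * (x⁻¹ ^ (n - 1 - i) / √k * (y⁻¹ ^ (n - 1 - i) / √k))
      = (∑ j ∈ Finset.range n, f j * (x * y)⁻¹ ^ j) / k := by
  rw [Finset.sum_range_reflect (fun i => f i * (x⁻¹ ^ i / √k * (y⁻¹ ^ i / √k))), Finset.sum_div]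
  refine Finset.sum_congr rfl fun j _ => ?_
  rw [div_mul_div_comm, Real.mul_self_sqrt hk.le, mul_inv, mul_pow, mul_div_assoc (f j)]

lemma sum_inv_pow_reflect_div_sqrt_mul {x y k : ℝ} (hk : 0 < k) (n : ℕ) :
    ∑ i ∈ Finset.range n, x⁻¹ ^ (n - 1 - i) / √k * (y⁻¹ ^ (n - 1 - i) / √k)
      = (∑ j ∈ Finset.range n, (x * y)⁻¹ ^ j) / k := by
  simpa only [one_mul] using
    sum_mul_inv_pow_reflect_div_sqrt_mul (x := x) (y := y) hk (fun _ => 1) n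

lemma tendsto_inv_sqrt {k : ℕ → ℝ} (hk : Tendsto k atTop atTop) :
    Tendsto (fun n => (√(k n))⁻¹) atTop (𝓝 0) :=
  tendsto_inv_atTop_zero.comp (Real.tendsto_sqrt_atTop.comp hk)

lemma abs_inv_pow_div_sqrt_le {x k : ℝ} (hx : 1 < x) (j : ℕ) :
    |x⁻¹ ^ j / √k| ≤ (√k)⁻¹ := by
  have h : x⁻¹ ^ j ≤ 1 := pow_le_one₀ (by positivity) (inv_le_one_of_one_le₀ hx.le)
  rw [abs_of_nonneg (by positivity), div_eq_mul_inv]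
  exact mul_le_of_le_one_left (by positivity) h

section DistinctRates

variable {k α β : ℕ → ℝ} {a b : ℝ}

/-- The coefficients of the innovations in the normalized autoregressive errors are asymptotically
a rank one array. -/
lemma tendsto_arError_coefficients (hk : Tendsto k atTop atTop)
    (ht : Tendsto (fun n : ℕ => (n : ℝ) / k n) atTop atTop) (hb : 0 < b)
    (hβ : Tendsto (fun n => k n * (β n - 1)) atTop (𝓝 b)) (c : ℝ) :
    Tendsto (fun n => ∑ i ∈ Finset.range n, ∑ j ∈ Finset.range n,
      ((if j < i + 1 then c * (β n ^ (i - j) * (β n)⁻¹ ^ n / k n) else 0)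
        - c * ((β n)⁻¹ ^ (n - 1 - i) / √(k n)) * ((β n)⁻¹ ^ (j + 1) / √(k n))) ^ 2)
      atTop (𝓝 0) := by
  have h := (tendsto_future_coefficients hk ht (by positivity)
    (tendsto_mul_mul_sub_one hk hβ hβ) 0).const_mul (c ^ 2)
  rw [mul_zero] at h
  refine tendsto_of_tendsto_of_tendsto_of_le_of_le' tendsto_const_nhds h
    (Eventually.of_forall fun n => Finset.sum_nonneg fun i _ => Finset.sum_nonneg fun j _ =>
      sq_nonneg _) ?_
  filter_upwards [hk.eventually_gt_atTop 0, eventually_one_lt_of_tendsto_mul_sub_one hk hb hβ]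
    with n h1 h2
  simp only [pow_zero, one_mul, Finset.sum_div, Finset.mul_sum]
  refine Finset.sum_le_sum fun i hi => Finset.sum_le_sum fun j hj => ?_
  have hin : i < n := Finset.mem_range.1 hi
  rw [mul_assoc]
  split_ifs with h3 h4 h4
  · rw [inv_pow_div_sqrt_mul_of_le (by positivity) h1 (by omega) hin, sub_self]
    rw [zero_pow two_ne_zero]
    positivity
  · rw [inv_pow_div_sqrt_mul_of_le (by positivity) h1 (by omega) hin, sub_self]
    simp
  · rw [inv_pow_div_sqrt_mul_of_ge h1 h4 hin, mul_inv]
    apply le_of_eq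
    ring
  · omega

/-- The coefficients of the innovations in the normalized process: the slower of the two exponential
terms is negligible, and the other one is asymptotically a rank one array. -/
lemma tendsto_arProcess_coefficients (hk : Tendsto k atTop atTop)
    (ht : Tendsto (fun n : ℕ => (n : ℝ) / k n) atTop atTop) (hb : 0 < b) (hab : b < a)
    (hα : Tendsto (fun n => k n * (α n - 1)) atTop (𝓝 a))
    (hβ : Tendsto (fun n => k n * (β n - 1)) atTop (𝓝 b)) :
    Tendsto (fun n => ∑ i ∈ Finset.range n, ∑ j ∈ Finset.range n,
      ((if j < i then (α n ^ (i - j) - β n ^ (i - j)) * (α n)⁻¹ ^ n / k n else 0)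
        - (α n)⁻¹ ^ (n - 1 - i) / √(k n) * ((α n)⁻¹ ^ (j + 1) / √(k n))) ^ 2)
      atTop (𝓝 0) := by
  have ha : 0 < a := hb.trans hab
  have hββ := tendsto_mul_mul_sub_one hk hβ hβ
  have hαβ := tendsto_pow_mul_inv_pow hk ht (sub_pos.2 hab) (tendsto_mul_div_sub_one hk hα hβ) 0
  simp only [pow_zero, one_mul] at hαβ
  have h := (((tendsto_sum_inv_pow_div hk ht (by positivity) hββ).mul
    (tendsto_sum_inv_pow_succ_div hk ht (by positivity) hββ)).mul (hαβ.pow 2)).add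
    (tendsto_future_coefficients hk ht (by positivity) (tendsto_mul_mul_sub_one hk hα hα) 0)
  have e : 1 / (b + b) * (1 / (b + b)) * 0 ^ 2 + 0 = 0 := by ring
  rw [e] at h
  refine tendsto_of_tendsto_of_tendsto_of_le_of_le' tendsto_const_nhds h
    (Eventually.of_forall fun n => Finset.sum_nonneg fun i _ => Finset.sum_nonneg fun j _ =>
      sq_nonneg _) ?_
  filter_upwards [hk.eventually_gt_atTop 0, eventually_one_lt_of_tendsto_mul_sub_one hk hb hβ,
    eventually_one_lt_of_tendsto_mul_sub_one hk ha hα] with n h1 h2 h2'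
  rw [← sum_inv_pow_reflect_div_sqrt_mul h1, ← sum_inv_pow_div_sqrt_mul h1, Finset.sum_mul_sum,
    Finset.sum_mul]
  simp only [pow_zero, one_mul, Finset.sum_div, Finset.mul_sum, Finset.sum_mul]
  rw [← Finset.sum_add_distrib]
  refine Finset.sum_le_sum fun i hi => ?_
  rw [← Finset.sum_add_distrib]
  refine Finset.sum_le_sum fun j hj => ?_
  have hin : i < n := Finset.mem_range.1 hi
  have hα0 : α n ≠ 0 := by positivity
  have hβ0 : β n ≠ 0 := by positivity
  rcases lt_or_ge j i with h3 | h3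
  · rw [if_pos h3, if_neg (by omega), inv_pow_div_sqrt_mul_of_le hα0 h1 h3.le hin, zero_div,
      mul_zero, add_zero]
    have e := inv_pow_div_sqrt_mul_of_le hβ0 h1 h3.le hin
    apply le_of_eq
    calc _ = (β n ^ (i - j) * (α n)⁻¹ ^ n / k n) ^ 2 := by ring
      _ = ((β n ^ (i - j) * (β n)⁻¹ ^ n / k n) * (α n / β n)⁻¹ ^ n) ^ 2 := by
          congr 1
          rw [inv_div, div_pow, inv_pow, inv_pow]
          field_simp
      _ = _ := by
          rw [← e]
          ring
  · rw [if_neg (by omega), if_pos h3, inv_pow_div_sqrt_mul_of_ge h1 h3 hin]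
    have e : (0 - (α n)⁻¹ ^ n * (α n)⁻¹ ^ (j - i) / k n) ^ 2
        = (α n * α n)⁻¹ ^ n * ((α n * α n)⁻¹ ^ (j - i) / k n ^ 2) := by
      rw [mul_inv]; ring
    rw [e]
    exact le_add_of_nonneg_left (by positivity)

/-- The limit theorem for distinct rates, in a form symmetric under exchange of the two
parameters. -/
theorem tendstoInDistribution_of_lt
    {Ω Ω' : Type*} [MeasurableSpace Ω] [MeasurableSpace Ω']
    {P : Measure Ω} [IsProbabilityMeasure P] {P' : Measure Ω'} [IsProbabilityMeasure P']
    {V : ℕ → Ω → ℝ} {v : ℝ} (hindep : iIndepFun (fun j => V (j + 1)) P)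
    (hident : ∀ j, IdentDistrib (V (j + 1)) (V 1) P P)
    (hL2 : MemLp (V 1) 2 P) (hmean : ∫ ω, V 1 ω ∂P = 0) (hvar : ∫ ω, V 1 ω ^ 2 ∂P = v)
    (hv : 0 < v) (hk : Tendsto k atTop atTop)
    (ht : Tendsto (fun n : ℕ => (n : ℝ) / k n) atTop atTop) (hb : 0 < b) (hab : b < a)
    (hα : ∀ᶠ n in atTop, α n = 1 + a / k n) (hβ : ∀ᶠ n in atTop, β n = 1 + b / k n)
    {φ ζ : Ω' → ℝ}
    (hlaw : HasLaw (fun ω => !₂[φ ω, ζ ω]) (multivariateGaussian 0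
      !![v / (2 * a), v / (a + b); v / (a + b), v / (2 * b)]) P')
    {Z : ℕ → Ω → ℝ} (hZm : ∀ n, AEMeasurable (Z n) P)
    (hZ : ∀ᶠ n in atTop, ∀ ω,
      ∑ i ∈ Finset.range n, arProcess (α n) (β n) (fun j => V j ω) i ^ 2 ≠ 0 →
      Z n ω = (a + b) / (2 * a * (a - b)) * (k n * α n ^ n * (β n ^ n)⁻¹ *
        ((∑ i ∈ Finset.range n, arProcess (α n) (β n) (fun j => V j ω) i *
            arError (β n) (fun j => V j ω) (i + 1)) /
          ∑ i ∈ Finset.range n, arProcess (α n) (β n) (fun j => V j ω) i ^ 2))) :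
    TendstoInDistribution Z atTop (fun ω => ζ ω / φ ω) (fun _ => P) P' := by
  have ha : 0 < a := hb.trans hab
  have hlin : ∀ {γ : ℕ → ℝ} {c : ℝ}, (∀ᶠ n in atTop, γ n = 1 + c / k n) →
      Tendsto (fun n => k n * (γ n - 1)) atTop (𝓝 c) := by
    intro γ c h
    refine tendsto_const_nhds.congr' ?_
    filter_upwards [h, hk.eventually_gt_atTop 0] with n h1 h2
    rw [h1]
    field_simp
    ring
  have hα' := hlin hα
  have hβ' := hlin hβ
  have hαα := tendsto_mul_mul_sub_one hk hα' hα'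
  have hαβ := tendsto_mul_mul_sub_one hk hα' hβ'
  have hββ := tendsto_mul_mul_sub_one hk hβ' hβ'
  have hk0 := hk.eventually_gt_atTop 0
  have hα1 := eventually_one_lt_of_tendsto_mul_sub_one hk ha hα'
  have hβ1 := eventually_one_lt_of_tendsto_mul_sub_one hk hb hβ'
  set c : ℝ := (a + b) / (2 * a) with hc
  have hcov : (!![v / (2 * a), v / (a + b); v / (a + b), v / (2 * b)] : Matrix (Fin 2) (Fin 2) ℝ)
      = !![v * (1 / (a + a)), v * (1 / (a + b)); v * (1 / (a + b)), v * (1 / (b + b))] := by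
    simp only [← two_mul, mul_one_div]
  rw [hcov] at hlaw
  have hdet : 0 ≤ v * (1 / (a + a)) * (v * (1 / (b + b))) - (v * (1 / (a + b))) ^ 2 := by
    have : v * (1 / (a + a)) * (v * (1 / (b + b))) - (v * (1 / (a + b))) ^ 2
        = v ^ 2 * (a - b) ^ 2 / (4 * a * b * (a + b) ^ 2) := by
      field_simp
      ring
    rw [this]
    positivity
  have hA : 0 < v * (1 / (a + a)) := by positivity
  refine tendstoInDistribution_quotient (W := fun j => V (j + 1)) hindep hident hL2 hmean hvar
    (w := fun n j => (α n)⁻¹ ^ (j + 1) / √(k n)) (w' := fun n j => (β n)⁻¹ ^ (j + 1) / √(k n))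
    (tendsto_inv_sqrt hk) (tendsto_inv_sqrt hk)
    (hα1.mono fun n h j _ => abs_inv_pow_div_sqrt_le h _)
    (hβ1.mono fun n h j _ => abs_inv_pow_div_sqrt_le h _)
    ?_ ?_ ?_ (posSemidef_two_by_two hA hdet) (ae_ne_zero_of_hasLaw hA hdet hlaw) hlaw
    (a := fun n i j =>
      if j < i then (α n ^ (i - j) - β n ^ (i - j)) * (α n)⁻¹ ^ n / k n else 0)
    (b := fun n i j => if j < i + 1 then c * (β n ^ (i - j) * (β n)⁻¹ ^ n / k n) else 0)
    (u := fun n i => (α n)⁻¹ ^ (n - 1 - i) / √(k n)) (s := fun _ _ => 0)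
    (s' := fun n i => c * ((β n)⁻¹ ^ (n - 1 - i) / √(k n)))
    (κ := 1 / (a + a)) (m := 0) (m' := c ^ 2 * (1 / (b + b))) (by positivity)
    ?_ (by simp) ?_ (by simp) ?_ (tendsto_arProcess_coefficients hk ht hb hab hα' hβ')
    (by simpa using tendsto_arError_coefficients hk ht hb hβ' c) hZm ?_
  · refine (tendsto_sum_inv_pow_succ_div hk ht (by positivity) hαα).congr' (hk0.mono fun n h => ?_)
    simp only [sq, sum_inv_pow_div_sqrt_mul h]
  · refine (tendsto_sum_inv_pow_succ_div hk ht (by positivity) hαβ).congr' (hk0.mono fun n h => ?_)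
    simp only [sum_inv_pow_div_sqrt_mul h]
  · refine (tendsto_sum_inv_pow_succ_div hk ht (by positivity) hββ).congr' (hk0.mono fun n h => ?_)
    simp only [sq, sum_inv_pow_div_sqrt_mul h]
  · refine (tendsto_sum_inv_pow_div hk ht (by positivity) hαα).congr' (hk0.mono fun n h => ?_)
    simp only [sq, sum_inv_pow_reflect_div_sqrt_mul h]
  · refine ((tendsto_sum_inv_pow_div hk ht (by positivity) hββ).const_mul (c ^ 2)).congr'
      (hk0.mono fun n h => ?_)
    simp only [mul_pow, ← Finset.mul_sum]
    simp only [sq, sum_inv_pow_reflect_div_sqrt_mul h]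
  · have e : c * (1 / (a + b)) = 1 / (a + a) := by
      rw [hc]
      field_simp
      ring
    rw [← e]
    refine ((tendsto_sum_inv_pow_div hk ht (by positivity) hαβ).const_mul c).congr'
      (hk0.mono fun n h => ?_)
    rw [← sum_inv_pow_reflect_div_sqrt_mul h, Finset.mul_sum]
    exact Finset.sum_congr rfl fun i _ => by ring
  · filter_upwards [hZ, hk0, hα1, hβ1, hα, hβ] with n hZ h1 h2 h3 h4 h5 ω hD
    have hα0 : α n ≠ 0 := by positivity
    have hβ0 : β n ≠ 0 := by positivity
    have hab0 : a - b ≠ 0 := (sub_pos.2 hab).ne'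
    have hdiff : α n - β n = (a - b) / k n := by rw [h4, h5]; ring
    have hx : ∀ i ∈ Finset.range n, ∑ j ∈ Finset.range n, (if j < i then
        (α n ^ (i - j) - β n ^ (i - j)) * (α n)⁻¹ ^ n / k n else 0) * V (j + 1) ω
        = (a - b) / (k n ^ 2 * α n ^ n) * arProcess (α n) (β n) (fun j => V j ω) i := by
      intro i hi
      simp only [ite_mul, zero_mul]
      rw [sum_range_ite_lt (Finset.mem_range.1 hi).le]
      have e1 := sub_mul_arProcess (α n) (β n) (fun j => V j ω) i
      rw [hdiff, mul_arError_eq_sum, mul_arError_eq_sum, ← Finset.sum_sub_distrib] at e1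
      have e2 : (a - b) / (k n ^ 2 * α n ^ n) * arProcess (α n) (β n) (fun j => V j ω) i
          = (α n)⁻¹ ^ n / k n * ((a - b) / k n * arProcess (α n) (β n) (fun j => V j ω) i) := by
        rw [inv_pow]
        field_simp
      rw [e2, e1, Finset.mul_sum]
      exact Finset.sum_congr rfl fun j _ => by ring
    have hy : ∀ i ∈ Finset.range n, ∑ j ∈ Finset.range n, (if j < i + 1 then
        c * (β n ^ (i - j) * (β n)⁻¹ ^ n / k n) else 0) * V (j + 1) ω
        = c / (k n * β n ^ n) * arError (β n) (fun j => V j ω) (i + 1) := by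
      intro i hi
      simp only [ite_mul, zero_mul]
      rw [sum_range_ite_lt (Finset.mem_range.1 hi), arError_succ_eq_sum, Finset.mul_sum]
      refine Finset.sum_congr rfl fun j _ => ?_
      rw [inv_pow]
      field_simp
    have hDeq : ∑ i ∈ Finset.range n, (∑ j ∈ Finset.range n, (if j < i then
        (α n ^ (i - j) - β n ^ (i - j)) * (α n)⁻¹ ^ n / k n else 0) * V (j + 1) ω) ^ 2
        = ((a - b) / (k n ^ 2 * α n ^ n)) ^ 2 *
          ∑ i ∈ Finset.range n, arProcess (α n) (β n) (fun j => V j ω) i ^ 2 := by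
      rw [Finset.mul_sum]
      refine Finset.sum_congr rfl fun i hi => ?_
      rw [hx i hi, mul_pow]
    have hNeq : ∑ i ∈ Finset.range n, (∑ j ∈ Finset.range n, (if j < i then
        (α n ^ (i - j) - β n ^ (i - j)) * (α n)⁻¹ ^ n / k n else 0) * V (j + 1) ω) *
        (∑ j ∈ Finset.range n, (if j < i + 1 then
          c * (β n ^ (i - j) * (β n)⁻¹ ^ n / k n) else 0) * V (j + 1) ω)
        = (a - b) / (k n ^ 2 * α n ^ n) * (c / (k n * β n ^ n)) *
          ∑ i ∈ Finset.range n, arProcess (α n) (β n) (fun j => V j ω) i *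
            arError (β n) (fun j => V j ω) (i + 1) := by
      rw [Finset.mul_sum]
      refine Finset.sum_congr rfl fun i hi => ?_
      rw [hx i hi, hy i hi]
      ring
    rw [hDeq] at hD
    have hD' := right_ne_zero_of_mul hD
    rw [hDeq, hNeq, hZ ω hD', hc]
    generalize ∑ i ∈ Finset.range n, arProcess (α n) (β n) (fun j => V j ω) i *
            arError (β n) (fun j => V j ω) (i + 1) = N
    generalize ∑ i ∈ Finset.range n, arProcess (α n) (β n) (fun j => V j ω) i ^ 2 = D at hD' ⊢
    field_simp

end DistinctRates

/-! ### Equal rates of explosion -/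

section EqualRates

variable {k θ : ℕ → ℝ} {γ : ℝ}

lemma tendsto_sum_moment_forward (hk : Tendsto k atTop atTop)
    (ht : Tendsto (fun n : ℕ => (n : ℝ) / k n) atTop atTop) (hγ : 0 < γ)
    (hθ : Tendsto (fun n => k n * (θ n - 1)) atTop (𝓝 γ)) :
    Tendsto (fun n => ∑ j ∈ Finset.range n,
        ((θ n)⁻¹ ^ (j + 1) / √(k n) * ((θ n)⁻¹ ^ (j + 1) / √(k n)))) atTop
        (𝓝 (1 / (γ + γ))) ∧
      Tendsto (fun n => ∑ j ∈ Finset.range n, ((j : ℝ) + 1) / k n *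
        ((θ n)⁻¹ ^ (j + 1) / √(k n) * ((θ n)⁻¹ ^ (j + 1) / √(k n)))) atTop
        (𝓝 (1 / (γ + γ) ^ 2)) ∧
      Tendsto (fun n => ∑ j ∈ Finset.range n, (((j : ℝ) + 1) / k n) ^ 2 *
        ((θ n)⁻¹ ^ (j + 1) / √(k n) * ((θ n)⁻¹ ^ (j + 1) / √(k n)))) atTop
        (𝓝 (2 / (γ + γ) ^ 3)) := by
  have hθθ := tendsto_mul_mul_sub_one hk hθ hθ
  have hk0 := hk.eventually_gt_atTop 0
  refine ⟨?_, ?_, ?_⟩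
  · refine (tendsto_sum_inv_pow_succ_div hk ht (by positivity) hθθ).congr' (hk0.mono fun n h => ?_)
    beta_reduce
    rw [sum_inv_pow_div_sqrt_mul h]
  · refine (tendsto_sum_mul_inv_pow_succ_div hk ht (by positivity) hθθ).congr'
      (hk0.mono fun n h => ?_)
    beta_reduce
    rw [sum_mul_inv_pow_div_sqrt_mul h, Finset.sum_div, Finset.sum_div]
    exact Finset.sum_congr rfl fun j _ => by ring
  · refine (tendsto_sum_sq_mul_inv_pow_succ_div hk ht (by positivity) hθθ).congr'
      (hk0.mono fun n h => ?_)
    beta_reduce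
    rw [sum_mul_inv_pow_div_sqrt_mul h, Finset.sum_div, Finset.sum_div]
    exact Finset.sum_congr rfl fun j _ => by ring

lemma tendsto_sum_moment_backward (hk : Tendsto k atTop atTop)
    (ht : Tendsto (fun n : ℕ => (n : ℝ) / k n) atTop atTop) (hγ : 0 < γ)
    (hθ : Tendsto (fun n => k n * (θ n - 1)) atTop (𝓝 γ)) :
    Tendsto (fun n => ∑ i ∈ Finset.range n,
        ((θ n)⁻¹ ^ (n - 1 - i) / √(k n) * ((θ n)⁻¹ ^ (n - 1 - i) / √(k n)))) atTop
        (𝓝 (1 / (γ + γ))) ∧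
      Tendsto (fun n => ∑ i ∈ Finset.range n, ((n - 1 - i : ℕ) : ℝ) / k n *
        ((θ n)⁻¹ ^ (n - 1 - i) / √(k n) * ((θ n)⁻¹ ^ (n - 1 - i) / √(k n)))) atTop
        (𝓝 (1 / (γ + γ) ^ 2)) ∧
      Tendsto (fun n => ∑ i ∈ Finset.range n, (((n - 1 - i : ℕ) : ℝ) / k n) ^ 2 *
        ((θ n)⁻¹ ^ (n - 1 - i) / √(k n) * ((θ n)⁻¹ ^ (n - 1 - i) / √(k n)))) atTop
        (𝓝 (2 / (γ + γ) ^ 3)) := by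
  have hθθ := tendsto_mul_mul_sub_one hk hθ hθ
  have hk0 := hk.eventually_gt_atTop 0
  refine ⟨?_, ?_, ?_⟩
  · refine (tendsto_sum_inv_pow_div hk ht (by positivity) hθθ).congr' (hk0.mono fun n h => ?_)
    beta_reduce
    rw [sum_inv_pow_reflect_div_sqrt_mul h]
  · refine (tendsto_sum_mul_inv_pow_div hk ht (by positivity) hθθ).congr'
      (hk0.mono fun n h => ?_)
    beta_reduce
    rw [sum_mul_inv_pow_reflect_div_sqrt_mul h (fun m => (m : ℝ) / k n), Finset.sum_div,
      Finset.sum_div]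
    exact Finset.sum_congr rfl fun j _ => by ring
  · refine (tendsto_sum_sq_mul_inv_pow_div hk ht (by positivity) hθθ).congr'
      (hk0.mono fun n h => ?_)
    beta_reduce
    rw [sum_mul_inv_pow_reflect_div_sqrt_mul h (fun m => ((m : ℝ) / k n) ^ 2), Finset.sum_div,
      Finset.sum_div]
    exact Finset.sum_congr rfl fun j _ => by ring

/-- The coefficients of the innovations in the process with a double root, normalized by its
leading order: past innovations contribute a relative error of order `k / n`. -/
lemma tendsto_arProcess_self_coefficients (hk : Tendsto k atTop atTop)
    (ht : Tendsto (fun n : ℕ => (n : ℝ) / k n) atTop atTop) (hγ : 0 < γ)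
    (hθ : Tendsto (fun n => k n * (θ n - 1)) atTop (𝓝 γ)) :
    Tendsto (fun n => ∑ i ∈ Finset.range n, ∑ j ∈ Finset.range n,
      ((if j < i then ((i : ℝ) - j) / n * (θ n ^ (i - j) * (θ n)⁻¹ ^ n / k n) else 0)
        - (θ n)⁻¹ ^ (n - 1 - i) / √(k n) * ((θ n)⁻¹ ^ (j + 1) / √(k n))) ^ 2)
      atTop (𝓝 0) := by
  have hθθ := tendsto_mul_mul_sub_one hk hθ hθ
  have hinv : Tendsto (fun n : ℕ => (((n : ℝ) / k n)⁻¹) ^ 2) atTop (𝓝 (0 ^ 2)) :=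
    (tendsto_inv_atTop_zero.comp ht).pow 2
  obtain ⟨f0, f1, f2⟩ := tendsto_sum_moment_forward hk ht hγ hθ
  obtain ⟨b0, b1, b2⟩ := tendsto_sum_moment_backward hk ht hγ hθ
  have h := ((((b2.mul f0).add (b0.mul f2)).const_mul 2).mul hinv).add
    (tendsto_future_coefficients hk ht (by positivity) hθθ 0)
  rw [zero_pow two_ne_zero, mul_zero, zero_add] at h
  refine tendsto_of_tendsto_of_tendsto_of_le_of_le' tendsto_const_nhds h
    (Eventually.of_forall fun n => Finset.sum_nonneg fun i _ => Finset.sum_nonneg fun j _ =>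
      sq_nonneg _) ?_
  filter_upwards [hk.eventually_gt_atTop 0, eventually_one_lt_of_tendsto_mul_sub_one hk hγ hθ,
    eventually_gt_atTop 0] with n h1 h2 hn
  rw [Finset.sum_mul_sum, Finset.sum_mul_sum, ← Finset.sum_add_distrib]
  simp only [pow_zero, one_mul, Finset.sum_div, Finset.mul_sum, Finset.sum_mul]
  rw [← Finset.sum_add_distrib]
  refine Finset.sum_le_sum fun i hi => ?_
  rw [← Finset.sum_add_distrib, Finset.mul_sum, Finset.sum_mul, ← Finset.sum_add_distrib]
  refine Finset.sum_le_sum fun j hj => ?_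
  have hin : i < n := Finset.mem_range.1 hi
  have hθ0 : θ n ≠ 0 := by positivity
  have hn0 : (0 : ℝ) < n := by exact_mod_cast hn
  rcases lt_or_ge j i with h3 | h3
  · rw [if_pos h3, if_neg (by omega), ← inv_pow_div_sqrt_mul_of_le hθ0 h1 h3.le hin, zero_div,
      mul_zero, add_zero]
    have hm : ((n - 1 - i : ℕ) : ℝ) = n - 1 - i := by
      rw [Nat.cast_sub (by omega), Nat.cast_sub (by omega)]
      simp
    rw [hm]
    generalize (θ n)⁻¹ ^ (n - 1 - i) / √(k n) = x
    generalize (θ n)⁻¹ ^ (j + 1) / √(k n) = y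
    have e1 : ((i - j : ℝ) / n * (x * y) - x * y) ^ 2
        = ((n - 1 - i + (j + 1) : ℝ)) ^ 2 * (x * y / n) ^ 2 := by
      field_simp
      ring
    have e2 : 2 * (((n - 1 - i : ℝ) / k n) ^ 2 * (x * x) * (y * y)
          + x * x * (((j + 1 : ℝ) / k n) ^ 2 * (y * y))) * ((n : ℝ) / k n)⁻¹ ^ 2
        = 2 * ((n - 1 - i : ℝ) ^ 2 + (j + 1 : ℝ) ^ 2) * (x * y / n) ^ 2 := by
      field_simp
    rw [e1, e2]
    exact mul_le_mul_of_nonneg_right add_sq_le (sq_nonneg _)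
  · rw [if_neg (by omega), if_pos h3]
    have e : (0 - (θ n)⁻¹ ^ (n - 1 - i) / √(k n) * ((θ n)⁻¹ ^ (j + 1) / √(k n))) ^ 2
        = (θ n * θ n)⁻¹ ^ n * ((θ n * θ n)⁻¹ ^ (j - i) / k n ^ 2) := by
      rw [inv_pow_div_sqrt_mul_of_ge h1 h3 hin, mul_inv]
      ring
    rw [e]
    exact le_add_of_nonneg_left (by positivity)

/-- The coefficients of the innovations in `n ε - θ X`, normalized. The cancellation between the two
terms leaves, up to innovations in the future of the observation, an array of rank two. -/
lemma tendsto_combined_coefficients (hk : Tendsto k atTop atTop)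
    (ht : Tendsto (fun n : ℕ => (n : ℝ) / k n) atTop atTop) (hγ : 0 < γ)
    (hθ : Tendsto (fun n => k n * (θ n - 1)) atTop (𝓝 γ)) :
    Tendsto (fun n => ∑ i ∈ Finset.range n, ∑ j ∈ Finset.range n,
      ((if j < i + 1 then
          θ n * (((n : ℝ) - i + j) / k n * (θ n ^ (i - j) * (θ n)⁻¹ ^ n / k n)) else 0)
        - (θ n * ((((n - 1 - i : ℕ) : ℝ) / k n - 1 / (γ + γ)) *
              ((θ n)⁻¹ ^ (n - 1 - i) / √(k n))) * ((θ n)⁻¹ ^ (j + 1) / √(k n))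
          + θ n * ((θ n)⁻¹ ^ (n - 1 - i) / √(k n)) *
            ((((j : ℝ) + 1) / k n + 1 / (γ + γ)) * ((θ n)⁻¹ ^ (j + 1) / √(k n))))) ^ 2)
      atTop (𝓝 0) := by
  have hθθ := tendsto_mul_mul_sub_one hk hθ hθ
  have h := (((tendsto_one_of_tendsto_mul_sub_one hk hθ).pow 2).const_mul 4).mul
    (tendsto_future_coefficients hk ht (by positivity) hθθ 2)
  rw [mul_zero] at h
  refine tendsto_of_tendsto_of_tendsto_of_le_of_le' tendsto_const_nhds h
    (Eventually.of_forall fun n => Finset.sum_nonneg fun i _ => Finset.sum_nonneg fun j _ =>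
      sq_nonneg _) ?_
  filter_upwards [hk.eventually_gt_atTop 0, eventually_one_lt_of_tendsto_mul_sub_one hk hγ hθ]
    with n h1 h2
  simp only [Finset.sum_div, Finset.mul_sum]
  refine Finset.sum_le_sum fun i hi => Finset.sum_le_sum fun j hj => ?_
  have hin : i < n := Finset.mem_range.1 hi
  have hjn : j < n := Finset.mem_range.1 hj
  have hθ0 : θ n ≠ 0 := by positivity
  have hm : ((n - 1 - i : ℕ) : ℝ) = n - 1 - i := by
    rw [Nat.cast_sub (by omega), Nat.cast_sub (by omega)]
    simp
  have e : θ n * ((((n - 1 - i : ℕ) : ℝ) / k n - 1 / (γ + γ)) *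
        ((θ n)⁻¹ ^ (n - 1 - i) / √(k n))) * ((θ n)⁻¹ ^ (j + 1) / √(k n))
      + θ n * ((θ n)⁻¹ ^ (n - 1 - i) / √(k n)) *
        ((((j : ℝ) + 1) / k n + 1 / (γ + γ)) * ((θ n)⁻¹ ^ (j + 1) / √(k n)))
      = θ n * (((n : ℝ) - i + j) / k n *
        ((θ n)⁻¹ ^ (n - 1 - i) / √(k n) * ((θ n)⁻¹ ^ (j + 1) / √(k n)))) := by
    rw [hm]
    ring
  rw [e]
  split_ifs with h3 h4 h4
  · rw [inv_pow_div_sqrt_mul_of_le hθ0 h1 (by omega) hin, sub_self, zero_pow two_ne_zero]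
    positivity
  · rw [inv_pow_div_sqrt_mul_of_le hθ0 h1 (by omega) hin, sub_self]
    simp
  · rw [inv_pow_div_sqrt_mul_of_ge h1 h4 hin]
    have e1 : (0 - θ n * (((n : ℝ) - i + j) / k n * ((θ n)⁻¹ ^ n * (θ n)⁻¹ ^ (j - i) / k n))) ^ 2
        = ((n : ℝ) - i + j) ^ 2 * (θ n ^ 2 / k n ^ 2 * ((θ n * θ n)⁻¹ ^ n *
          ((θ n * θ n)⁻¹ ^ (j - i) / k n ^ 2))) := by
      rw [mul_inv]
      ring
    have e2 : 4 * θ n ^ 2 * (((n : ℝ) / k n) ^ 2 * ((θ n * θ n)⁻¹ ^ n *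
          ((θ n * θ n)⁻¹ ^ (j - i) / k n ^ 2)))
        = (2 * (n : ℝ)) ^ 2 * (θ n ^ 2 / k n ^ 2 * ((θ n * θ n)⁻¹ ^ n *
          ((θ n * θ n)⁻¹ ^ (j - i) / k n ^ 2))) := by
      ring
    rw [e1, e2]
    have h5 : (i : ℝ) ≤ n := by exact_mod_cast hin.le
    have h6 : (j : ℝ) ≤ n := by exact_mod_cast hjn.le
    have h7 : (0 : ℝ) ≤ i := i.cast_nonneg
    have h8 : (0 : ℝ) ≤ j := j.cast_nonneg
    refine mul_le_mul_of_nonneg_right ?_ (by positivity)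
    exact pow_le_pow_left₀ (by linarith) (by linarith) 2
  · omega

/-- The limit theorem for equal rates. The numerator `∑ X (n ε - θ X)` is of smaller order than
either of its two parts, and its limit involves the variable
`S = ∑ ((j + 1) / k + 1 / (2 γ)) θ ^ (-(j + 1)) V_{j+1} / √k`. -/
theorem tendstoInDistribution_of_eq
    {Ω Ω' : Type*} [MeasurableSpace Ω] [MeasurableSpace Ω']
    {P : Measure Ω} [IsProbabilityMeasure P] {P' : Measure Ω'} [IsProbabilityMeasure P']
    {V : ℕ → Ω → ℝ} {v : ℝ} (hindep : iIndepFun (fun j => V (j + 1)) P)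
    (hident : ∀ j, IdentDistrib (V (j + 1)) (V 1) P P)
    (hL2 : MemLp (V 1) 2 P) (hmean : ∫ ω, V 1 ω ∂P = 0) (hvar : ∫ ω, V 1 ω ^ 2 ∂P = v)
    (hv : 0 < v) (hk : Tendsto k atTop atTop)
    (ht : Tendsto (fun n : ℕ => (n : ℝ) / k n) atTop atTop) (hγ : 0 < γ)
    (hθ : ∀ᶠ n in atTop, θ n = 1 + γ / k n)
    {φ ζ : Ω' → ℝ}
    (hlaw : HasLaw (fun ω => !₂[φ ω, ζ ω]) (multivariateGaussian 0
      !![v / (2 * γ), v / (2 * γ ^ 2); v / (2 * γ ^ 2), 5 * v / (8 * γ ^ 3)]) P')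
    {Z : ℕ → Ω → ℝ} (hZm : ∀ n, AEMeasurable (Z n) P)
    (hZ : ∀ᶠ n in atTop, ∀ ω,
      ∑ i ∈ Finset.range n, arProcess (θ n) (θ n) (fun j => V j ω) i ^ 2 ≠ 0 →
      Z n ω = (n : ℝ) / k n * ((n : ℝ) *
        ((∑ i ∈ Finset.range n, arProcess (θ n) (θ n) (fun j => V j ω) i *
            arError (θ n) (fun j => V j ω) (i + 1)) /
          ∑ i ∈ Finset.range n, arProcess (θ n) (θ n) (fun j => V j ω) i ^ 2) - θ n)) :
    TendstoInDistribution Z atTop (fun ω => ζ ω / φ ω) (fun _ => P) P' := by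
  have hk0 := hk.eventually_gt_atTop 0
  have hθ' : Tendsto (fun n => k n * (θ n - 1)) atTop (𝓝 γ) := by
    refine tendsto_const_nhds.congr' ?_
    filter_upwards [hθ, hk0] with n h1 h2
    rw [h1]
    field_simp
    ring
  have hθ1 := eventually_one_lt_of_tendsto_mul_sub_one hk hγ hθ'
  have hθlim := tendsto_one_of_tendsto_mul_sub_one hk hθ'
  obtain ⟨f0, f1, f2⟩ := tendsto_sum_moment_forward hk ht hγ hθ'
  obtain ⟨b0, b1, b2⟩ := tendsto_sum_moment_backward hk ht hγ hθ'
  set c : ℝ := 1 / (γ + γ) with hc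
  have hcov : (!![v / (2 * γ), v / (2 * γ ^ 2); v / (2 * γ ^ 2), 5 * v / (8 * γ ^ 3)] :
      Matrix (Fin 2) (Fin 2) ℝ)
      = !![v * c, v * (1 / (γ + γ) ^ 2 + c * c); v * (1 / (γ + γ) ^ 2 + c * c),
        v * (2 / (γ + γ) ^ 3 + 2 * c * (1 / (γ + γ) ^ 2) + c ^ 2 * c)] := by
    have e1 : v / (2 * γ) = v * c := by rw [hc]; field_simp; ring
    have e2 : v / (2 * γ ^ 2) = v * (1 / (γ + γ) ^ 2 + c * c) := by rw [hc]; field_simp; ring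
    have e3 : 5 * v / (8 * γ ^ 3)
        = v * (2 / (γ + γ) ^ 3 + 2 * c * (1 / (γ + γ) ^ 2) + c ^ 2 * c) := by
      rw [hc]; field_simp; ring
    rw [e1, e2, e3]
  rw [hcov] at hlaw
  have hA : 0 < v * c := by positivity
  have hdet : 0 ≤ v * c * (v * (2 / (γ + γ) ^ 3 + 2 * c * (1 / (γ + γ) ^ 2) + c ^ 2 * c))
      - (v * (1 / (γ + γ) ^ 2 + c * c)) ^ 2 := by
    have : v * c * (v * (2 / (γ + γ) ^ 3 + 2 * c * (1 / (γ + γ) ^ 2) + c ^ 2 * c))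
      - (v * (1 / (γ + γ) ^ 2 + c * c)) ^ 2 = v ^ 2 / (16 * γ ^ 4) := by
      rw [hc]; field_simp; ring
    rw [this]
    positivity
  refine tendstoInDistribution_quotient (W := fun j => V (j + 1)) hindep hident hL2 hmean hvar
    (w := fun n j => (θ n)⁻¹ ^ (j + 1) / √(k n))
    (w' := fun n j => (((j : ℝ) + 1) / k n + c) * ((θ n)⁻¹ ^ (j + 1) / √(k n)))
    (δ' := fun n => (γ⁻¹ + c) * (√(k n))⁻¹)
    (tendsto_inv_sqrt hk) (by simpa using (tendsto_inv_sqrt hk).const_mul (γ⁻¹ + c))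
    (hθ1.mono fun n h j _ => abs_inv_pow_div_sqrt_le h _) ?_
    ?_ ?_ ?_ (posSemidef_two_by_two hA hdet) (ae_ne_zero_of_hasLaw hA hdet hlaw) hlaw
    (a := fun n i j =>
      if j < i then ((i : ℝ) - j) / n * (θ n ^ (i - j) * (θ n)⁻¹ ^ n / k n) else 0)
    (b := fun n i j => if j < i + 1 then
      θ n * (((n : ℝ) - i + j) / k n * (θ n ^ (i - j) * (θ n)⁻¹ ^ n / k n)) else 0)
    (u := fun n i => (θ n)⁻¹ ^ (n - 1 - i) / √(k n))
    (s := fun n i => θ n * ((((n - 1 - i : ℕ) : ℝ) / k n - c) *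
      ((θ n)⁻¹ ^ (n - 1 - i) / √(k n))))
    (s' := fun n i => θ n * ((θ n)⁻¹ ^ (n - 1 - i) / √(k n)))
    (κ := c) (m := 1 ^ 2 * (2 / (γ + γ) ^ 3 - 2 * c * (1 / (γ + γ) ^ 2) + c ^ 2 * c))
    (m' := 1 ^ 2 * c) (by positivity)
    ?_ ?_ ?_ ?_ ?_ (tendsto_arProcess_self_coefficients hk ht hγ hθ')
    (tendsto_combined_coefficients hk ht hγ hθ') hZm ?_
  · filter_upwards [hk0, hθ1, hθ] with n h1 h2 h3 j _
    -- Bernoulli's inequality bounds `(j + 1) θ ^ (-(j + 1))` by `k / γ`.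
    have hB : ((j : ℝ) + 1) / k n * (θ n)⁻¹ ^ (j + 1) ≤ γ⁻¹ := by
      have hb := one_add_mul_le_pow (a := γ / k n) (by have : 0 < γ / k n := by positivity
                                                       linarith) (j + 1)
      rw [← h3] at hb
      push_cast at hb
      rw [inv_pow, ← div_eq_mul_inv, div_le_iff₀ (by positivity)]
      calc ((j : ℝ) + 1) / k n = γ⁻¹ * (((j : ℝ) + 1) * (γ / k n)) := by field_simp
        _ ≤ γ⁻¹ * θ n ^ (j + 1) := by
          gcongr
          linarith
    have hB' : (θ n)⁻¹ ^ (j + 1) ≤ 1 := pow_le_one₀ (by positivity) (inv_le_one_of_one_le₀ h2.le)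
    rw [abs_of_nonneg (by positivity)]
    calc _ = (((j : ℝ) + 1) / k n * (θ n)⁻¹ ^ (j + 1) + c * (θ n)⁻¹ ^ (j + 1)) * (√(k n))⁻¹ := by
          ring
      _ ≤ (γ⁻¹ + c * 1) * (√(k n))⁻¹ := by gcongr
      _ = _ := by ring
  · simpa only [sq] using f0
  · refine (f1.add (f0.const_mul c)).congr fun n => ?_
    rw [Finset.mul_sum, ← Finset.sum_add_distrib]
    exact Finset.sum_congr rfl fun j _ => by ring
  · refine ((f2.add (f1.const_mul (2 * c))).add (f0.const_mul (c ^ 2))).congr fun n => ?_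
    rw [Finset.mul_sum, Finset.mul_sum, ← Finset.sum_add_distrib, ← Finset.sum_add_distrib]
    exact Finset.sum_congr rfl fun j _ => by ring
  · simpa only [sq] using b0
  · refine ((hθlim.pow 2).mul ((b2.sub (b1.const_mul (2 * c))).add
      (b0.const_mul (c ^ 2)))).congr fun n => ?_
    rw [Finset.mul_sum, Finset.mul_sum, ← Finset.sum_sub_distrib, ← Finset.sum_add_distrib,
      Finset.mul_sum]
    exact Finset.sum_congr rfl fun j _ => by ring
  · refine ((hθlim.pow 2).mul b0).congr fun n => ?_
    rw [Finset.mul_sum]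
    exact Finset.sum_congr rfl fun j _ => by ring
  · have e : 1 * (1 / (γ + γ) ^ 2 - c * c) = 0 := by rw [hc]; field_simp; ring
    rw [← e]
    refine (hθlim.mul (b1.sub (b0.const_mul c))).congr fun n => ?_
    rw [Finset.mul_sum, ← Finset.sum_sub_distrib, Finset.mul_sum]
    exact Finset.sum_congr rfl fun j _ => by ring
  · have h := hθlim.mul b0
    rw [one_mul] at h
    refine h.congr fun n => ?_
    rw [Finset.mul_sum]
    exact Finset.sum_congr rfl fun j _ => by ring
  · filter_upwards [hZ, hk0, hθ1, eventually_gt_atTop 0] with n hZ h1 h2 hn ω hD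
    have hθ0 : θ n ≠ 0 := by positivity
    have hn0 : (n : ℝ) ≠ 0 := by exact_mod_cast hn.ne'
    have hx : ∀ i ∈ Finset.range n, ∑ j ∈ Finset.range n, (if j < i then
        ((i : ℝ) - j) / n * (θ n ^ (i - j) * (θ n)⁻¹ ^ n / k n) else 0) * V (j + 1) ω
        = θ n / (n * k n * θ n ^ n) * arProcess (θ n) (θ n) (fun j => V j ω) i := by
      intro i hi
      simp only [ite_mul, zero_mul]
      rw [sum_range_ite_lt (Finset.mem_range.1 hi).le, div_mul_eq_mul_div,
        mul_arProcess_self_eq_sum, Finset.sum_div]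
      refine Finset.sum_congr rfl fun j _ => ?_
      rw [inv_pow]
      field_simp
    have hy : ∀ i ∈ Finset.range n, ∑ j ∈ Finset.range n, (if j < i + 1 then
        θ n * (((n : ℝ) - i + j) / k n * (θ n ^ (i - j) * (θ n)⁻¹ ^ n / k n)) else 0) *
          V (j + 1) ω
        = θ n / (k n ^ 2 * θ n ^ n) * (n * arError (θ n) (fun j => V j ω) (i + 1)
          - θ n * arProcess (θ n) (θ n) (fun j => V j ω) i) := by
      intro i hi
      have e : θ n * arProcess (θ n) (θ n) (fun j => V j ω) i
          = ∑ j ∈ Finset.range (i + 1), ((i : ℝ) - j) * θ n ^ (i - j) * V (j + 1) ω := by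
        rw [mul_arProcess_self_eq_sum, Finset.sum_range_succ]
        simp
      simp only [ite_mul, zero_mul]
      rw [sum_range_ite_lt (Finset.mem_range.1 hi), arError_succ_eq_sum, e, Finset.mul_sum,
        ← Finset.sum_sub_distrib, Finset.mul_sum]
      refine Finset.sum_congr rfl fun j _ => ?_
      rw [inv_pow]
      field_simp
      ring
    have hDeq : ∑ i ∈ Finset.range n, (∑ j ∈ Finset.range n, (if j < i then
        ((i : ℝ) - j) / n * (θ n ^ (i - j) * (θ n)⁻¹ ^ n / k n) else 0) * V (j + 1) ω) ^ 2
        = (θ n / (n * k n * θ n ^ n)) ^ 2 *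
          ∑ i ∈ Finset.range n, arProcess (θ n) (θ n) (fun j => V j ω) i ^ 2 := by
      rw [Finset.mul_sum]
      refine Finset.sum_congr rfl fun i hi => ?_
      rw [hx i hi, mul_pow]
    have hNeq : ∑ i ∈ Finset.range n, (∑ j ∈ Finset.range n, (if j < i then
        ((i : ℝ) - j) / n * (θ n ^ (i - j) * (θ n)⁻¹ ^ n / k n) else 0) * V (j + 1) ω) *
        (∑ j ∈ Finset.range n, (if j < i + 1 then
          θ n * (((n : ℝ) - i + j) / k n * (θ n ^ (i - j) * (θ n)⁻¹ ^ n / k n)) else 0) *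
            V (j + 1) ω)
        = θ n / (n * k n * θ n ^ n) * (θ n / (k n ^ 2 * θ n ^ n)) *
          (n * ∑ i ∈ Finset.range n, arProcess (θ n) (θ n) (fun j => V j ω) i *
            arError (θ n) (fun j => V j ω) (i + 1)
          - θ n * ∑ i ∈ Finset.range n, arProcess (θ n) (θ n) (fun j => V j ω) i ^ 2) := by
      rw [Finset.mul_sum _ _ (n : ℝ), Finset.mul_sum _ _ (θ n), ← Finset.sum_sub_distrib,
        Finset.mul_sum]
      refine Finset.sum_congr rfl fun i hi => ?_
      rw [hx i hi, hy i hi]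
      ring
    rw [hDeq] at hD
    have hD' := right_ne_zero_of_mul hD
    rw [hDeq, hNeq, hZ ω hD']
    generalize ∑ i ∈ Finset.range n, arProcess (θ n) (θ n) (fun j => V j ω) i *
            arError (θ n) (fun j => V j ω) (i + 1) = N
    generalize ∑ i ∈ Finset.range n, arProcess (θ n) (θ n) (fun j => V j ω) i ^ 2 = D at hD' ⊢
    field_simp

end EqualRates

/-! ### The limit laws -/

theorem theorem1
    {Ω Ω' : Type*} [MeasurableSpace Ω] [MeasurableSpace Ω']
    (P : Measure Ω) [IsProbabilityMeasure P] (P' : Measure Ω') [IsProbabilityMeasure P']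
    (V : ℕ → Ω → ℝ) (σ : ℝ) (hσ : 0 < σ)
    (hindep : iIndepFun (fun k : ℕ => V (k + 1)) P)
    (hident : ∀ k : ℕ, 1 ≤ k → IdentDistrib (V k) (V 1) P P)
    (hL2 : MemLp (V 1) 2 P) (hmean : ∫ ω, V 1 ω ∂P = 0) (hvar : variance (V 1) P = σ ^ 2)
    (k : ℕ → ℝ) (hkpos : ∀ n : ℕ, 1 ≤ n → 0 < k n) (hktop : Tendsto k atTop atTop)
    (hko : k =o[atTop] fun n : ℕ => (n : ℝ))
    (γ₁ γ₂ : ℝ) (hγ₁ : 0 < γ₁) (hγ₂ : 0 < γ₂)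
    (θ ρ : ℕ → ℝ) (hθ : ∀ n : ℕ, 1 ≤ n → θ n = 1 + γ₁ / k n)
    (hρ : ∀ n : ℕ, 1 ≤ n → ρ n = 1 + γ₂ / k n) :
    (γ₂ < γ₁ → ∀ ξθ ξρ : Ω' → ℝ,
      HasLaw (fun ω => !₂[ξθ ω, ξρ ω]) (multivariateGaussian 0 (covLambda σ γ₁ γ₂)) P' →
        TendstoInDistribution
          (fun (n : ℕ) ω => (γ₁ + γ₂) / (2 * γ₁ * (γ₁ - γ₂)) *
            (k n * θ n ^ n * (ρ n ^ n)⁻¹ * (thetaHat (θ n) (ρ n) n (fun j => V j ω) - θ n)))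
          atTop (fun ω => ξρ ω / ξθ ω) (fun _ => P) P' ∧
        ∃ s : ℝ≥0, 0 < s ∧
          HasLaw (fun ω => ξρ ω / ξθ ω) (cauchyMeasure (2 * γ₁ / (γ₁ + γ₂)) s) P') ∧
    (γ₁ < γ₂ → ∀ ξθ ξρ : Ω' → ℝ,
      HasLaw (fun ω => !₂[ξθ ω, ξρ ω]) (multivariateGaussian 0 (covLambda σ γ₁ γ₂)) P' →
        TendstoInDistribution
          (fun (n : ℕ) ω => (γ₁ + γ₂) / (2 * γ₂ * (γ₂ - γ₁)) *
            (ρ n ^ n * (θ n ^ n)⁻¹ *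
              (k n * (thetaHat (θ n) (ρ n) n (fun j => V j ω) - θ n) - (γ₂ - γ₁))))
          atTop (fun ω => ξθ ω / ξρ ω) (fun _ => P) P' ∧
        ∃ s : ℝ≥0, 0 < s ∧
          HasLaw (fun ω => ξθ ω / ξρ ω) (cauchyMeasure (2 * γ₂ / (γ₁ + γ₂)) s) P') ∧
    (γ₁ = γ₂ → ∀ φθ ζθ : Ω' → ℝ,
      HasLaw (fun ω => !₂[φθ ω, ζθ ω]) (multivariateGaussian 0 (covXi σ γ₁)) P' →
        TendstoInDistribution
          (fun (n : ℕ) ω => (n : ℝ) / k n *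
            ((n : ℝ) * (thetaHat (θ n) (ρ n) n (fun j => V j ω) - θ n) - θ n))
          atTop (fun ω => ζθ ω / φθ ω) (fun _ => P) P' ∧
        ∃ s : ℝ≥0, 0 < s ∧
          HasLaw (fun ω => ζθ ω / φθ ω) (cauchyMeasure (1 / γ₁) s) P') := by
  have hident' : ∀ j, IdentDistrib (V (j + 1)) (V 1) P P := fun j => hident (j + 1) (by omega)
  have hVm : ∀ j, AEMeasurable (V (j + 1)) P := fun j => (hident' j).aemeasurable_fst
  have hvar' : ∫ ω, V 1 ω ^ 2 ∂P = σ ^ 2 := by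
    rw [← hvar, variance_of_integral_eq_zero (hVm 0) hmean]
  have hv : 0 < σ ^ 2 := by positivity
  have ht : Tendsto (fun n : ℕ => (n : ℝ) / k n) atTop atTop := by
    have h1 := hko.tendsto_div_nhds_zero
    have h2 : Tendsto (fun n : ℕ => k n / (n : ℝ)) atTop (𝓝[>] 0) := by
      refine tendsto_nhdsWithin_iff.2 ⟨h1, ?_⟩
      filter_upwards [eventually_ge_atTop 1] with n hn
      exact div_pos (hkpos n hn) (by exact_mod_cast hn)
    refine (tendsto_inv_nhdsGT_zero.comp h2).congr fun n => ?_
    simp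
  have hθe : ∀ᶠ n in atTop, θ n = 1 + γ₁ / k n := eventually_atTop.2 ⟨1, hθ⟩
  have hρe : ∀ᶠ n in atTop, ρ n = 1 + γ₂ / k n := eventually_atTop.2 ⟨1, hρ⟩
  have hTm := fun n => aemeasurable_thetaHat hVm (θ n) (ρ n) n
  -- The determinant of the covariance matrix for distinct rates.
  have hdet : ∀ a b : ℝ, 0 < a → 0 < b → a ≠ b →
      0 < σ ^ 2 / (2 * a) * (σ ^ 2 / (2 * b)) - (σ ^ 2 / (a + b)) ^ 2 := by
    intro a b ha hb hab
    have h : σ ^ 2 / (2 * a) * (σ ^ 2 / (2 * b)) - (σ ^ 2 / (a + b)) ^ 2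
        = σ ^ 4 * (a - b) ^ 2 / (4 * a * b * (a + b) ^ 2) := by
      field_simp
      ring
    have hab' : a - b ≠ 0 := sub_ne_zero.2 hab
    rw [h]
    positivity
  have hcenter : ∀ a b : ℝ, 0 < a → 0 < b →
      σ ^ 2 / (a + b) / (σ ^ 2 / (2 * a)) = 2 * a / (a + b) := by
    intro a b ha hb
    field_simp
  have hswap : ∀ ξθ ξρ : Ω' → ℝ, γ₁ < γ₂ →
      HasLaw (fun ω => !₂[ξθ ω, ξρ ω]) (multivariateGaussian 0 (covLambda σ γ₁ γ₂)) P' →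
      HasLaw (fun ω => !₂[ξρ ω, ξθ ω]) (multivariateGaussian 0
        !![σ ^ 2 / (2 * γ₂), σ ^ 2 / (γ₂ + γ₁); σ ^ 2 / (γ₂ + γ₁), σ ^ 2 / (2 * γ₁)]) P' := by
    intro ξθ ξρ hlt hlaw
    rw [add_comm γ₂ γ₁]
    exact hasLaw_swap (by positivity) (by positivity) (hdet γ₁ γ₂ hγ₁ hγ₂ hlt.ne).le hlaw
  refine ⟨fun hlt ξθ ξρ hlaw => ⟨?_, ?_⟩, fun hlt ξθ ξρ hlaw => ⟨?_, ?_⟩,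
    fun heq φθ ζθ hlaw => ⟨?_, ?_⟩⟩
  · refine tendstoInDistribution_of_lt hindep hident' hL2 hmean hvar' hv hktop ht hγ₂ hlt hθe hρe
      hlaw (fun n => ((hTm n).sub_const _).const_mul _ |>.const_mul _) ?_
    refine Eventually.of_forall fun n ω hD => ?_
    rw [thetaHat_sub_eq hD]
  · rw [← hcenter γ₁ γ₂ hγ₁ hγ₂]
    exact hasLaw_quotient_cauchyMeasure (by positivity) (hdet γ₁ γ₂ hγ₁ hγ₂ hlt.ne') hlaw
  · refine tendstoInDistribution_of_lt hindep hident' hL2 hmean hvar' hv hktop ht hγ₁ hlt hρe hθe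
      (hswap ξθ ξρ hlt hlaw) (fun n => (((hTm n).sub_const _).const_mul _).sub_const _ |>.const_mul _
        |>.const_mul _) ?_
    filter_upwards [hθe, hρe, hktop.eventually_gt_atTop 0] with n h1 h2 h3 ω hD
    rw [← thetaHat_sub_eq' hD, h1, h2, add_comm γ₁ γ₂]
    field_simp
    ring
  · rw [add_comm γ₁ γ₂, ← hcenter γ₂ γ₁ hγ₂ hγ₁]
    exact hasLaw_quotient_cauchyMeasure (by positivity) (hdet γ₂ γ₁ hγ₂ hγ₁ hlt.ne') (hswap ξθ ξρ hlt hlaw)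
  · subst heq
    refine tendstoInDistribution_of_eq hindep hident' hL2 hmean hvar' hv hktop ht hγ₁ hθe hlaw
      (fun n => ((((hTm n).sub_const _).const_mul _).sub_const _).const_mul _) ?_
    filter_upwards [hθe, hρe] with n h1 h2 ω hD
    rw [h2, ← h1, thetaHat_sub_eq hD]
  · have h : σ ^ 2 / (2 * γ₁ ^ 2) / (σ ^ 2 / (2 * γ₁)) = 1 / γ₁ := by
      field_simp
    rw [← h]
    refine hasLaw_quotient_cauchyMeasure (by positivity) ?_ hlaw
    have h : σ ^ 2 / (2 * γ₁) * (5 * σ ^ 2 / (8 * γ₁ ^ 3)) - (σ ^ 2 / (2 * γ₁ ^ 2)) ^ 2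
        = σ ^ 4 / (16 * γ₁ ^ 4) := by
      field_simp
      ring
    rw [h]
    positivity
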